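/- **Theorem 3.3.** Let $p$ and $q$ be primes with $p\equiv 1\pmod 4$ and $q\equiv 3\pmod 8$. Let $c,d,x,y,m\in\mathbb Z$ satisfy $$p=c^2+d^2,\qquad 4p=x^2+qy^2,\qquad c\equiv y\equiv 1\pmod 4,$$ and assume that $\gcd(c,x+2d)=1$ or $\gcd(d,x+2c)=1$. Suppose that $$\Big(\frac{2(c-di)}{x}\Big)^{\frac{q+1}4}\equiv i^m\pmod q,$$ where $i=\sqrt{-1}$ and the congruence is taken in the ring of fractions $\gamma/t$ with $\gamma\in\mathbb Z[i]$ and $t\in\mathbb Z$ prime to $q$ (note that $q\nmid x$). Then $$(-q)^{\lfloor p/8\rfloor}\equiv\begin{cases}(-1)^{\lfloor x/4\rfloor+1}\left(\dfrac dc\right)^m\pmod p&\text{if }p\equiv 1\pmod 8,\\[2mm](-1)^{\frac{x^2-1}8}\left(\dfrac dc\right)^m\dfrac yx\pmod p&\text{if }p\equiv 5\pmod 8,\end{cases}$$ where $d/c$ and $y/x$ are quotients modulo $p$ (note that $p\nmid cdx$). -/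

import Mathlib

/-- Congruence modulo a rational integer `n` between complex numbers (in practice elements of
`ℚ(i)`, written as fractions): `α ≡ β (mod n)` in the ring of fractions of `ℤ[i]` whose denominators
are rational integers prime to `n`. It says that `α - β = n * γ / t` for some `γ ∈ ℤ[i]` and
some integer `t` prime to `n`. -/
def GaussianCongr (n : ℤ) (α β : ℂ) : Prop :=
  ∃ t : ℤ, IsCoprime t n ∧ ∃ γ : GaussianInt,
    (t : ℂ) * (α - β) = (n : ℂ) * GaussianInt.toComplex γ

/-! Put π = c + di, a Gaussian prime of norm p. Modulo p one has -q = (x/y)², so (-q)^⌊p/8⌋ equals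
(x/y)^((p-1)/4), times y/x when p ≡ 5 (mod 8). By Euler's criterion, x^((p-1)/4) and y^((p-1)/4) are
the images of the quartic symbols (x/π) and (y/π) under the map ℤ[i] → 𝔽_p with kernel (π), which
sends i to d/c. It remains to show (x/π) = i^(m+2e)(y/π), where (-1)^e is the sign in the theorem
(`quarticSymbol_eq_zpow_mul_quarticSymbol`).

The two symbols are compared through ω = x + 2π. With A = x + 2c, the identity ωω̄ = 2xA + qy² gives
(-q/ω)(y/ω)² = (2/ω)(x/ω)(A/ω). Reciprocity between rational and Gaussian integers turns the
factors, up to powers of i, into (ω/q), (π/y), (π/x) and (i/A), while (2/ω) is an explicit power of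
i (`quarticSymbol_add_two_mul_mul_quarticSymbol`). Finally ω^(q-1) ≡ ω̄/ω ≡ 2π̄/x (mod q), so the
hypothesis on m says exactly that (ω/q) = i^m (`quarticSymbol_add_two_mul_eq`). The condition gcd(d,
x+2c) = 1 makes the coordinates of ω coprime; under the other gcd condition the same argument is run
with -iπ = d - ci.

The reciprocity law (`quarticSymbol_intCast_eq`) comes from the quartic Gauss sum G modulo π: G⁴ =
pπ², and the Frobenius in characteristic ℓ evaluates G^ℓ. Only π² enters, so the normalisation π ≡ 1
(mod 2), which fixes π up to sign, is enough. -/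

open UniqueFactorizationMonoid

/-! ### Fourth roots of unity and the Frobenius map on ℤ[i] -/

namespace GaussianInt

/-- The imaginary unit of `ℤ[i]`. -/
def imagUnit : GaussianInt := ⟨0, 1⟩

theorem imagUnit_sq : imagUnit ^ 2 = -1 := by
  rw [sq]; rfl

theorem imagUnit_pow_four : imagUnit ^ 4 = 1 := by
  rw [show 4 = 2 * 2 from rfl, pow_mul, imagUnit_sq]; norm_num

theorem star_imagUnit : star imagUnit = -imagUnit := rfl

theorem eq_re_add_im_mul_imagUnit (α : GaussianInt) :
    α = (α.re : GaussianInt) + (α.im : GaussianInt) * imagUnit := by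
  ext <;> simp [imagUnit]

/-- If u ≠ v, dividing u⁴ - v⁴ = 0 by u - v gives u³ + u²v + uv² + v³ = 0. Modulo π this is 4v³ with
v a unit, which forces π ∣ 2. -/
theorem eq_of_pow_four_eq_one_of_dvd_sub {π u v : GaussianInt} (hπ : Prime π) (h2 : ¬ π ∣ 2)
    (hu : u ^ 4 = 1) (hv : v ^ 4 = 1) (h : π ∣ u - v) : u = v := by
  by_contra hne
  have h0 : u ^ 3 + u ^ 2 * v + u * v ^ 2 + v ^ 3 = 0 := by
    apply mul_left_cancel₀ (sub_ne_zero.mpr hne)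
    linear_combination hu - hv
  have h4 : π ∣ 2 * 2 * v ^ 3 := by
    have : 2 * 2 * v ^ 3 = (u - v) * (-(u ^ 2 + 2 * u * v + 3 * v ^ 2)) := by
      linear_combination h0
    rw [this]
    exact h.mul_right _
  rcases hπ.dvd_or_dvd h4 with h4 | h4
  · rcases hπ.dvd_or_dvd h4 with h4 | h4 <;> exact h2 h4
  · exact hπ.not_isUnit (isUnit_of_dvd_one (hv ▸ (hπ.dvd_of_dvd_pow h4).trans (dvd_pow_self v (by norm_num))))

/-- The ℓ-th power is additive modulo ℓ, and Fermat's theorem fixes both coordinates. -/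
theorem natPrime_dvd_pow_sub {ℓ : ℕ} (hℓ : ℓ.Prime) (α : GaussianInt) :
    (ℓ : GaussianInt) ∣ α ^ ℓ - (α.re + α.im * imagUnit ^ ℓ) := by
  obtain ⟨r, hr⟩ := exists_add_pow_prime_eq hℓ (α.re : GaussianInt) (α.im * imagUnit)
  have hint (a : ℤ) : (ℓ : GaussianInt) ∣ (a : GaussianInt) ^ ℓ - a := by
    have := Fact.mk hℓ
    have : (ℓ : ℤ) ∣ a ^ ℓ - a := by
      rw [← ZMod.intCast_zmod_eq_zero_iff_dvd]
      push_cast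
      rw [ZMod.pow_card, sub_self]
    exact_mod_cast (Int.cast_dvd_cast (α := GaussianInt) _ _ this)
  obtain ⟨s, hs⟩ := hint α.re
  obtain ⟨t, ht⟩ := hint α.im
  have hα : α ^ ℓ = (α.re + α.im * imagUnit) ^ ℓ := by rw [← eq_re_add_im_mul_imagUnit]
  refine ⟨s + imagUnit ^ ℓ * t + α.re * (α.im * imagUnit) * r, ?_⟩
  rw [hα, hr, mul_pow]
  linear_combination hs + imagUnit ^ ℓ * ht

theorem imagUnit_pow_of_mod_four_eq_one {n : ℕ} (hn : n % 4 = 1) : imagUnit ^ n = imagUnit := by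
  rw [← Nat.div_add_mod n 4, hn, pow_add, pow_mul, imagUnit_pow_four]; simp

theorem imagUnit_pow_of_mod_four_eq_three {n : ℕ} (hn : n % 4 = 3) : imagUnit ^ n = -imagUnit := by
  rw [← Nat.div_add_mod n 4, hn, pow_add, pow_mul, imagUnit_pow_four, pow_succ, imagUnit_sq]; simp

theorem natPrime_dvd_pow_sub_self {ℓ : ℕ} (hℓ : ℓ.Prime) (h : ℓ % 4 = 1) (α : GaussianInt) :
    (ℓ : GaussianInt) ∣ α ^ ℓ - α := by
  have := natPrime_dvd_pow_sub hℓ α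
  rwa [imagUnit_pow_of_mod_four_eq_one h, ← eq_re_add_im_mul_imagUnit] at this

theorem natPrime_dvd_pow_sub_star {ℓ : ℕ} (hℓ : ℓ.Prime) (h : ℓ % 4 = 3) (α : GaussianInt) :
    (ℓ : GaussianInt) ∣ α ^ ℓ - star α := by
  have := natPrime_dvd_pow_sub hℓ α
  rw [imagUnit_pow_of_mod_four_eq_three h] at this
  convert this using 2
  ext <;> simp [imagUnit]

theorem natPrime_dvd_pow_sq_sub_self {ℓ : ℕ} (hℓ : ℓ.Prime) (h : ℓ % 4 = 3) (α : GaussianInt) :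
    (ℓ : GaussianInt) ∣ α ^ (ℓ ^ 2) - α := by
  have h1 := natPrime_dvd_pow_sub_star hℓ h (star α)
  have h2 := (natPrime_dvd_pow_sub_star hℓ h α).trans (sub_dvd_pow_sub_pow _ _ ℓ)
  rw [star_star] at h1
  have := dvd_add h1 h2
  rw [← pow_mul, ← sq] at this
  convert this using 1
  ring

/-! ### Odd Gaussian primes and Fermat's theorem for them -/

/-- An odd Gaussian prime is inert or split. -/
theorem inert_or_split_of_prime {π : GaussianInt} (hπ : Prime π) (h2 : ¬ π ∣ 2) :
    (∃ ℓ : ℕ, ℓ.Prime ∧ ℓ % 4 = 3 ∧ Associated π ℓ ∧ π.norm = ℓ ^ 2) ∨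
    (∃ ℓ : ℕ, ℓ.Prime ∧ ℓ % 4 = 1 ∧ π ∣ ℓ ∧ π.norm = ℓ) := by
  have hex : ∃ ℓ : ℕ, ℓ.Prime ∧ π ∣ ℓ := by
    have h : π ∣ (π.norm.natAbs : GaussianInt) := by
      have : (π.norm.natAbs : GaussianInt) = π * star π := by
        rw [← Zsqrtd.norm_eq_mul_conj, GaussianInt.natCast_natAbs_norm]
      rw [this]; exact dvd_mul_right _ _
    have hn : π.norm.natAbs ≠ 0 := by simpa [GaussianInt.norm_eq_zero] using hπ.ne_zero
    generalize π.norm.natAbs = n at h hn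
    induction n using Nat.recOnMul with
    | zero => exact absurd rfl hn
    | one => exact absurd (isUnit_of_dvd_one (by simpa using h)) hπ.not_isUnit
    | prime p hp => exact ⟨p, hp, h⟩
    | mul a b iha ihb =>
      rw [Nat.cast_mul] at h
      rcases hπ.dvd_or_dvd h with h | h
      · exact iha h (by rintro rfl; simp at hn)
      · exact ihb h (by rintro rfl; simp at hn)
  obtain ⟨ℓ, hℓ, τ, hτ⟩ := hex
  have hℓ2 : ℓ ≠ 2 := by
    rintro rfl
    exact h2 ⟨τ, hτ⟩
  have hodd : ℓ % 2 = 1 := hℓ.eq_two_or_odd.resolve_left hℓ2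
  have hN : π.norm.natAbs * τ.norm.natAbs = ℓ ^ 2 := by
    rw [← Int.natAbs_mul, ← Zsqrtd.norm_mul, ← hτ, Zsqrtd.norm_natCast, ← Nat.cast_mul,
      Int.natAbs_natCast, sq]
  have hcast (n : ℕ) (h : π.norm.natAbs = n) : π.norm = n := by
    rw [← h, GaussianInt.abs_natCast_norm]
  obtain ⟨k, hk, hk'⟩ := (Nat.dvd_prime_pow hℓ).1 (Dvd.intro _ hN)
  interval_cases k
  · exact absurd (Zsqrtd.norm_eq_one_iff.1 (by simpa using hk')) hπ.not_isUnit
  · right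
    refine ⟨ℓ, hℓ, ?_, ⟨τ, hτ⟩, hcast _ (by simpa using hk')⟩
    have h3 : (ℓ : ℤ) = π.re ^ 2 + π.im ^ 2 := by
      rw [← hcast _ (by simpa using hk'), Zsqrtd.norm_def]; ring
    have h4 : (ℓ : ℤ) % 4 = 1 := by
      have h5 : (ℓ : ℤ) % 2 = 1 := by omega
      rw [h3] at h5 ⊢
      rcases Int.even_or_odd' π.re with ⟨a, ha | ha⟩ <;>
        rcases Int.even_or_odd' π.im with ⟨b, hb | hb⟩ <;> rw [ha, hb] at h5 ⊢ <;> ring_nf at h5 ⊢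
        <;> omega
    omega
  · left
    have hu : IsUnit τ := by
      rw [← Zsqrtd.norm_eq_one_iff]
      rw [hk'] at hN
      exact Nat.eq_of_mul_eq_mul_left (pow_pos hℓ.pos 2) (by rw [hN, mul_one])
    have hass : Associated π ℓ := ⟨hu.unit, by rw [hτ]; rfl⟩
    have := Fact.mk hℓ
    exact ⟨ℓ, hℓ, GaussianInt.mod_four_eq_three_of_nat_prime_of_prime ℓ (hass.prime hπ), hass,
      by rw [hcast _ hk']; push_cast; rfl⟩

theorem natAbs_norm_mod_four_of_prime {π : GaussianInt} (hπ : Prime π) (h2 : ¬ π ∣ 2) :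
    π.norm.natAbs % 4 = 1 := by
  rcases inert_or_split_of_prime hπ h2 with ⟨ℓ, -, h, -, hN⟩ | ⟨ℓ, -, h, -, hN⟩
  · rw [hN, Int.natAbs_pow, Int.natAbs_natCast, Nat.pow_mod, h]
  · rw [hN, Int.natAbs_natCast, h]

theorem prime_dvd_pow_norm_sub_self {π : GaussianInt} (hπ : Prime π) (h2 : ¬ π ∣ 2)
    (α : GaussianInt) : π ∣ α ^ π.norm.natAbs - α := by
  rcases inert_or_split_of_prime hπ h2 with ⟨ℓ, hℓ, h, hd, hN⟩ | ⟨ℓ, hℓ, h, hd, hN⟩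
  · rw [hN, Int.natAbs_pow, Int.natAbs_natCast]
    exact hd.dvd.trans (natPrime_dvd_pow_sq_sub_self hℓ h α)
  · rw [hN, Int.natAbs_natCast]
    exact hd.trans (natPrime_dvd_pow_sub_self hℓ h α)

theorem eq_of_pow_four_eq_one {u : GaussianInt} (hu : u ^ 4 = 1) :
    u = 1 ∨ u = -1 ∨ u = imagUnit ∨ u = -imagUnit := by
  have h : (u - 1) * ((u + 1) * ((u - imagUnit) * (u + imagUnit))) = 0 := by
    linear_combination hu + (1 - u ^ 2) * imagUnit_sq
  simpa only [mul_eq_zero, sub_eq_zero, add_eq_zero_iff_eq_neg] using h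

/-- With N π = 4k + 1, the element α^N - α is α times the product of α^k - u over the four units u.
The prime π divides one of these factors. -/
theorem exists_dvd_pow_sub {π α : GaussianInt} (hπ : Prime π) (h2 : ¬ π ∣ 2) (hα : ¬ π ∣ α) :
    ∃ u : GaussianInt, u ^ 4 = 1 ∧ π ∣ α ^ (π.norm.natAbs / 4) - u := by
  have h1 := prime_dvd_pow_norm_sub_self hπ h2 α
  set k := π.norm.natAbs / 4 with hk
  have hN : π.norm.natAbs = k * 4 + 1 := by
    have := natAbs_norm_mod_four_of_prime hπ h2
    omega
  have h3 : π ∣ α * ((α ^ k - 1) * ((α ^ k + 1) * ((α ^ k - imagUnit) * (α ^ k + imagUnit)))) := by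
    convert h1 using 1
    rw [hN, pow_succ, pow_mul]
    linear_combination (α * (1 - (α ^ k) ^ 2)) * imagUnit_sq
  rcases hπ.dvd_or_dvd h3 with h | h
  · exact absurd h hα
  rcases hπ.dvd_or_dvd h with h | h
  · exact ⟨1, one_pow 4, h⟩
  rcases hπ.dvd_or_dvd h with h | h
  · exact ⟨-1, by norm_num, by simpa using h⟩
  rcases hπ.dvd_or_dvd h with h | h
  · exact ⟨imagUnit, imagUnit_pow_four, h⟩
  · exact ⟨-imagUnit, by rw [neg_pow, imagUnit_pow_four]; norm_num, by simpa using h⟩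

/-! ### The quartic symbol modulo an odd Gaussian prime -/

open Classical in
/-- The quartic residue symbol of `α` modulo a Gaussian prime `π`: the power `u` of the imaginary
unit with `α ^ ((N π - 1) / 4) ≡ u (mod π)`, or `0` if there is none. -/
noncomputable def primeQuarticSymbol (α π : GaussianInt) : GaussianInt :=
  if h : ∃ u : GaussianInt, u ^ 4 = 1 ∧ π ∣ α ^ (π.norm.natAbs / 4) - u then h.choose else 0

section primeSymbol

variable {π : GaussianInt} (hπ : Prime π) (h2 : ¬ π ∣ 2)
include hπ h2

theorem primeQuarticSymbol_spec {α : GaussianInt} (hα : ¬ π ∣ α) :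
    primeQuarticSymbol α π ^ 4 = 1 ∧ π ∣ α ^ (π.norm.natAbs / 4) - primeQuarticSymbol α π := by
  have h := exists_dvd_pow_sub hπ h2 hα
  rw [primeQuarticSymbol, dif_pos h]
  exact h.choose_spec

theorem primeQuarticSymbol_eq {α u : GaussianInt} (hu : u ^ 4 = 1)
    (h : π ∣ α ^ (π.norm.natAbs / 4) - u) : primeQuarticSymbol α π = u := by
  have hex : ∃ u : GaussianInt, u ^ 4 = 1 ∧ π ∣ α ^ (π.norm.natAbs / 4) - u := ⟨u, hu, h⟩
  rw [primeQuarticSymbol, dif_pos hex]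
  refine eq_of_pow_four_eq_one_of_dvd_sub hπ h2 hex.choose_spec.1 hu ?_
  convert dvd_sub h hex.choose_spec.2 using 1
  ring

theorem primeQuarticSymbol_of_dvd {α : GaussianInt} (hα : π ∣ α) : primeQuarticSymbol α π = 0 := by
  rw [primeQuarticSymbol, dif_neg]
  rintro ⟨u, hu, h⟩
  -- A vanishing exponent would make the power 1 even when π ∣ α; it is excluded because N π ≡ 1
  -- (mod 4) and N π ≠ 1.
  have hk : π.norm.natAbs / 4 ≠ 0 := by
    have h4 := natAbs_norm_mod_four_of_prime hπ h2
    have h1 : π.norm.natAbs ≠ 1 := fun h => hπ.not_isUnit (Zsqrtd.norm_eq_one_iff.1 h)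
    omega
  have hdvd : π ∣ u := (dvd_sub_right (hα.trans (dvd_pow_self α hk))).1 h
  exact hπ.not_isUnit (isUnit_of_dvd_one (hu ▸ hdvd.trans (dvd_pow_self u (by norm_num))))

theorem primeQuarticSymbol_mul (α β : GaussianInt) :
    primeQuarticSymbol (α * β) π = primeQuarticSymbol α π * primeQuarticSymbol β π := by
  by_cases hα : π ∣ α
  · rw [primeQuarticSymbol_of_dvd hπ h2 hα, primeQuarticSymbol_of_dvd hπ h2 (hα.mul_right β),
      zero_mul]
  by_cases hβ : π ∣ β
  · rw [primeQuarticSymbol_of_dvd hπ h2 hβ, primeQuarticSymbol_of_dvd hπ h2 (hβ.mul_left α),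
      mul_zero]
  obtain ⟨h1, h3⟩ := primeQuarticSymbol_spec hπ h2 hα
  obtain ⟨h4, h5⟩ := primeQuarticSymbol_spec hπ h2 hβ
  refine primeQuarticSymbol_eq hπ h2 (by rw [mul_pow, h1, h4, one_mul]) ?_
  convert dvd_add (h3.mul_right (β ^ (π.norm.natAbs / 4)))
    (h5.mul_left (primeQuarticSymbol α π)) using 1
  rw [mul_pow]
  ring

theorem primeQuarticSymbol_congr {α β : GaussianInt} (h : π ∣ α - β) :
    primeQuarticSymbol α π = primeQuarticSymbol β π := by
  by_cases hβ : π ∣ β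
  · rw [primeQuarticSymbol_of_dvd hπ h2 hβ,
      primeQuarticSymbol_of_dvd hπ h2 ((dvd_sub_left hβ).1 h)]
  · obtain ⟨h1, h3⟩ := primeQuarticSymbol_spec hπ h2 hβ
    refine primeQuarticSymbol_eq hπ h2 h1 ?_
    convert dvd_add (h.trans (sub_dvd_pow_sub_pow α β (π.norm.natAbs / 4))) h3 using 1
    ring

theorem primeQuarticSymbol_associated (α : GaussianInt) {π' : GaussianInt} (h : Associated π π') :
    primeQuarticSymbol α π = primeQuarticSymbol α π' := by
  have hN : π.norm = π'.norm := Zsqrtd.norm_eq_of_associated (by norm_num) h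
  by_cases hα : π ∣ α
  · rw [primeQuarticSymbol_of_dvd hπ h2 hα, primeQuarticSymbol_of_dvd (h.prime hπ)
      (by rwa [← h.dvd_iff_dvd_left]) (h.dvd_iff_dvd_left.1 hα)]
  · obtain ⟨h1, h3⟩ := primeQuarticSymbol_spec hπ h2 hα
    refine (primeQuarticSymbol_eq (h.prime hπ) (by rwa [← h.dvd_iff_dvd_left]) h1 ?_).symm
    rwa [← hN, ← h.dvd_iff_dvd_left]

theorem primeQuarticSymbol_one : primeQuarticSymbol 1 π = 1 :=
  primeQuarticSymbol_eq hπ h2 (one_pow 4) (by simp)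

omit hπ h2 in
theorem star_dvd_star {α β : GaussianInt} (h : α ∣ β) : star α ∣ star β := by
  obtain ⟨γ, rfl⟩ := h
  exact ⟨star γ, by rw [star_mul, mul_comm]⟩

omit hπ h2 in
theorem prime_star {π : GaussianInt} (hπ : Prime π) : Prime (star π) :=
  (MulEquiv.prime_iff (starMulAut : MulAut GaussianInt)).2 hπ

omit hπ h2 in
theorem not_star_dvd_two {π : GaussianInt} (h2 : ¬ π ∣ 2) : ¬ star π ∣ 2 := fun h =>
  h2 (by simpa using star_dvd_star h)

theorem primeQuarticSymbol_star (α : GaussianInt) :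
    primeQuarticSymbol (star α) (star π) = star (primeQuarticSymbol α π) := by
  by_cases hα : π ∣ α
  · rw [primeQuarticSymbol_of_dvd hπ h2 hα, primeQuarticSymbol_of_dvd (prime_star hπ)
      (not_star_dvd_two h2) (star_dvd_star hα), star_zero]
  · obtain ⟨h1, h3⟩ := primeQuarticSymbol_spec hπ h2 hα
    refine primeQuarticSymbol_eq (prime_star hπ) (not_star_dvd_two h2) ?_ ?_
    · rw [← star_pow, h1, star_one]
    · rw [Zsqrtd.norm_conj]
      simpa using star_dvd_star h3

end primeSymbol

theorem mul_star_of_pow_four {u : GaussianInt} (hu : u ^ 4 = 1) : u * star u = 1 := by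
  rcases eq_of_pow_four_eq_one hu with rfl | rfl | rfl | rfl <;> rfl

/-! ### The Jacobi-type quartic symbol -/

/-- The quartic residue symbol `(α / ω)₄` of Jacobi type on `ℤ[i]`, the product of the symbols
modulo the prime factors of `ω`. -/
noncomputable def quarticSymbol (α ω : GaussianInt) : GaussianInt :=
  ((factors ω).map (primeQuarticSymbol α)).prod

theorem not_dvd_two_of_mem_factors {π ω : GaussianInt} (hω : IsCoprime ω 2) (hπ : π ∈ factors ω) :
    ¬ π ∣ 2 := fun h =>
  (prime_of_factor π hπ).not_isUnit (hω.isUnit_of_dvd' (dvd_of_mem_factors hπ) h)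

theorem ne_zero_of_isCoprime_two {ω : GaussianInt} (hω : IsCoprime ω 2) : ω ≠ 0 := by
  rintro rfl
  rw [isCoprime_zero_left, ← Zsqrtd.norm_eq_one_iff] at hω
  exact absurd hω (by decide)

/-- `factors` is determined only up to order and associates; this makes the product of prime symbols
independent of the choice, and hence multiplicative in the modulus. -/
theorem map_primeQuarticSymbol_eq_of_rel {s t : Multiset GaussianInt} (α : GaussianInt)
    (h : Multiset.Rel Associated s t) (hs : ∀ π ∈ s, Prime π ∧ ¬ π ∣ 2) :
    (s.map (primeQuarticSymbol α)).prod = (t.map (primeQuarticSymbol α)).prod := by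
  induction h with
  | zero => rfl
  | cons hab _ ih =>
    obtain ⟨h1, h2⟩ := hs _ (Multiset.mem_cons_self _ _)
    rw [Multiset.map_cons, Multiset.prod_cons, Multiset.map_cons, Multiset.prod_cons,
      ih fun π hπ => hs π (Multiset.mem_cons_of_mem hπ), primeQuarticSymbol_associated h1 h2 α hab]

theorem quarticSymbol_of_prime {π : GaussianInt} (hπ : Prime π) (h2 : ¬ π ∣ 2) (α : GaussianInt) :
    quarticSymbol α π = primeQuarticSymbol α π := by
  obtain ⟨τ, hτ, hτ'⟩ := prime_factors_irreducible hπ.irreducible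
    ⟨fun _ h => prime_of_factor _ h, factors_prod hπ.ne_zero⟩
  rw [quarticSymbol, hτ', Multiset.map_singleton, Multiset.prod_singleton,
    primeQuarticSymbol_associated hπ h2 α hτ]

theorem quarticSymbol_associated (α : GaussianInt) {ω ω' : GaussianInt} (hω : IsCoprime ω 2)
    (h : Associated ω ω') : quarticSymbol α ω = quarticSymbol α ω' :=
  map_primeQuarticSymbol_eq_of_rel α (factors_rel_of_associated h)
    fun π hπ => ⟨prime_of_factor π hπ, not_dvd_two_of_mem_factors hω hπ⟩

theorem quarticSymbol_mul_right (α : GaussianInt) {ω ω' : GaussianInt} (hω : IsCoprime ω 2)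
    (hω' : IsCoprime ω' 2) :
    quarticSymbol α (ω * ω') = quarticSymbol α ω * quarticSymbol α ω' := by
  rw [quarticSymbol, quarticSymbol, quarticSymbol, ← Multiset.prod_add, ← Multiset.map_add]
  exact map_primeQuarticSymbol_eq_of_rel α
    (factors_mul (ne_zero_of_isCoprime_two hω) (ne_zero_of_isCoprime_two hω'))
    fun π hπ => ⟨prime_of_factor π hπ, not_dvd_two_of_mem_factors (hω.mul_left hω') hπ⟩

theorem quarticSymbol_of_isUnit (α : GaussianInt) {ω : GaussianInt} (hω : IsUnit ω) :
    quarticSymbol α ω = 1 := by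
  rw [quarticSymbol, factors_of_isUnit hω, Multiset.map_zero, Multiset.prod_zero]

theorem quarticSymbol_one_right (α : GaussianInt) : quarticSymbol α 1 = 1 :=
  quarticSymbol_of_isUnit α isUnit_one

theorem quarticSymbol_neg_right (α : GaussianInt) {ω : GaussianInt} (hω : IsCoprime ω 2) :
    quarticSymbol α (-ω) = quarticSymbol α ω :=
  (quarticSymbol_associated α hω ((Associated.refl ω).neg_right)).symm

theorem quarticSymbol_mul_left (α β : GaussianInt) {ω : GaussianInt} (hω : IsCoprime ω 2) :
    quarticSymbol (α * β) ω = quarticSymbol α ω * quarticSymbol β ω := by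
  rw [quarticSymbol, quarticSymbol, quarticSymbol, ← Multiset.prod_map_mul]
  congr 1
  exact Multiset.map_congr rfl fun π hπ => primeQuarticSymbol_mul (prime_of_factor π hπ)
    (not_dvd_two_of_mem_factors hω hπ) α β

theorem quarticSymbol_one_left {ω : GaussianInt} (hω : IsCoprime ω 2) :
    quarticSymbol 1 ω = 1 := by
  rw [quarticSymbol, Multiset.map_congr rfl fun π hπ => primeQuarticSymbol_one
    (prime_of_factor π hπ) (not_dvd_two_of_mem_factors hω hπ)]
  simp

theorem quarticSymbol_pow_left (α : GaussianInt) (n : ℕ) {ω : GaussianInt} (hω : IsCoprime ω 2) :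
    quarticSymbol (α ^ n) ω = quarticSymbol α ω ^ n := by
  induction n with
  | zero => rw [pow_zero, pow_zero, quarticSymbol_one_left hω]
  | succ n ih => rw [pow_succ, pow_succ, quarticSymbol_mul_left _ _ hω, ih]

theorem quarticSymbol_congr {α β ω : GaussianInt} (hω : IsCoprime ω 2) (h : ω ∣ α - β) :
    quarticSymbol α ω = quarticSymbol β ω := by
  rw [quarticSymbol, quarticSymbol]
  congr 1
  exact Multiset.map_congr rfl fun π hπ => primeQuarticSymbol_congr (prime_of_factor π hπ)
    (not_dvd_two_of_mem_factors hω hπ) ((dvd_of_mem_factors hπ).trans h)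

/-! ### Odd Gaussian integers normalised modulo 2 -/

theorem isCoprime_of_prime {π α : GaussianInt} (hπ : Prime π) (h : ¬ π ∣ α) : IsCoprime π α :=
  (hπ.irreducible.coprime_iff_not_dvd).2 h

theorem isCoprime_two_of_dvd_sub_one {α : GaussianInt} (h : 2 ∣ α - 1) : IsCoprime α 2 := by
  obtain ⟨β, hβ⟩ := h
  exact ⟨1, -β, by linear_combination hβ⟩

theorem two_dvd_sub_one_iff {α : GaussianInt} : 2 ∣ α - 1 ↔ α.re % 2 = 1 ∧ α.im % 2 = 0 := by
  rw [show (2 : GaussianInt) = ((2 : ℤ) : GaussianInt) by norm_num, Zsqrtd.intCast_dvd]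
  simp only [Zsqrtd.re_sub, Zsqrtd.im_sub, Zsqrtd.re_one, Zsqrtd.im_one]
  omega

theorem norm_eq (α : GaussianInt) : α.norm = α.re ^ 2 + α.im ^ 2 := by
  rw [Zsqrtd.norm_def]; ring

theorem isCoprime_two_iff {α : GaussianInt} : IsCoprime α 2 ↔ α.norm % 2 = 1 := by
  constructor
  · rintro ⟨β, γ, h⟩
    have h1 : β.norm * α.norm = (1 - γ * 2).norm := by
      rw [← Zsqrtd.norm_mul]
      congr 1
      linear_combination h
    have h2 : (1 - γ * 2).norm % 2 = 1 := by
      have : (1 - γ * 2).norm = 1 + 2 * (-2 * γ.re + 2 * γ.re ^ 2 + 2 * γ.im ^ 2) := by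
        rw [norm_eq]
        simp
        ring
      omega
    rw [← h1, Int.mul_emod] at h2
    rcases Int.emod_two_eq_zero_or_one α.norm with h3 | h3
    · rw [h3] at h2; simp at h2
    · exact h3
  · intro h
    refine ⟨star α, -((α.norm / 2 : ℤ) : GaussianInt), ?_⟩
    have h1 := Zsqrtd.norm_eq_mul_conj α
    have h2 : α.norm = 2 * (α.norm / 2) + 1 := by omega
    rw [h2] at h1
    push_cast at h1
    linear_combination -h1

theorem isUnit_iff_pow_four_eq_one {u : GaussianInt} : IsUnit u ↔ u ^ 4 = 1 := by
  refine ⟨fun hu => ?_, fun hu => IsUnit.of_pow_eq_one hu (by norm_num)⟩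
  have h : u.re ^ 2 + u.im ^ 2 = 1 := by
    rw [← norm_eq, Zsqrtd.norm_eq_one_iff' (by norm_num)]
    exact hu
  have h1 : u.re ≤ 1 := by nlinarith
  have h2 : -1 ≤ u.re := by nlinarith
  have h3 : u.im ≤ 1 := by nlinarith
  have h4 : -1 ≤ u.im := by nlinarith
  obtain ⟨a, b⟩ := u
  simp only at *
  interval_cases a <;> interval_cases b <;> first | rfl | simp at h

theorem eq_one_or_neg_one_of_isUnit {u : GaussianInt} (hu : IsUnit u) (h : 2 ∣ u - 1) :
    u = 1 ∨ u = -1 := by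
  rw [two_dvd_sub_one_iff] at h
  rcases eq_of_pow_four_eq_one (isUnit_iff_pow_four_eq_one.1 hu) with rfl | rfl | rfl | rfl
  · exact Or.inl rfl
  · exact Or.inr rfl
  · exact absurd h.1 (by decide)
  · exact absurd h.1 (by decide)

/-- Every odd Gaussian integer has an associate that is congruent to `1` modulo `2`. -/
theorem exists_associated_two_dvd_sub_one {α : GaussianInt} (h : IsCoprime α 2) :
    ∃ β, Associated α β ∧ 2 ∣ β - 1 := by
  rw [isCoprime_two_iff, norm_eq] at h
  rcases Int.emod_two_eq_zero_or_one α.re with h1 | h1 <;>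
    rcases Int.emod_two_eq_zero_or_one α.im with h2 | h2
  · exact absurd h (by rw [Int.add_emod, sq, sq, Int.mul_emod, Int.mul_emod α.im, h1, h2]; decide)
  · have hi : IsUnit imagUnit := isUnit_iff_pow_four_eq_one.2 imagUnit_pow_four
    refine ⟨α * imagUnit, ⟨hi.unit, rfl⟩, two_dvd_sub_one_iff.2 ?_⟩
    simp [imagUnit]
    omega
  · exact ⟨α, Associated.refl α, two_dvd_sub_one_iff.2 ⟨h1, h2⟩⟩
  · exact absurd h (by rw [Int.add_emod, sq, sq, Int.mul_emod, Int.mul_emod α.im, h1, h2]; decide)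

/-- Induction along the prime factorization of Gaussian integers congruent to `1` modulo `2`. -/
theorem induction_of_two_dvd_sub_one {P : GaussianInt → Prop} (one : P 1) (neg_one : P (-1))
    (inert : ∀ ℓ : ℕ, ℓ.Prime → ℓ % 4 = 3 → P ℓ)
    (split : ∀ (π : GaussianInt) (ℓ : ℕ), Prime π → 2 ∣ π - 1 → ℓ.Prime → ℓ % 4 = 1 → π.norm = ℓ →
      P π)
    (mul : ∀ α β, 2 ∣ α - 1 → 2 ∣ β - 1 → P α → P β → P (α * β)) {α : GaussianInt}
    (hα : 2 ∣ α - 1) : P α := by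
  have hunit (u : GaussianInt) (hu : IsUnit u) (h : 2 ∣ u - 1) : P u := by
    rcases eq_one_or_neg_one_of_isUnit hu h with rfl | rfl
    · exact one
    · exact neg_one
  have hprime (π : GaussianInt) (hπ : Prime π) (h : 2 ∣ π - 1) : P π := by
    have h2 : ¬ π ∣ 2 := fun hd =>
      hπ.not_isUnit ((isCoprime_two_of_dvd_sub_one h).isUnit_of_dvd' dvd_rfl hd)
    rcases inert_or_split_of_prime hπ h2 with ⟨ℓ, hℓ, h4, ⟨u, hu⟩, hN⟩ | ⟨ℓ, hℓ, h4, -, hN⟩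
    · have hℓ2 : 2 ∣ (ℓ : GaussianInt) - 1 := two_dvd_sub_one_iff.2 (by simp; omega)
      have h1 : 2 ∣ ((u⁻¹ : (GaussianInt)ˣ) : GaussianInt) - 1 := by
        have h3 : π = ℓ * (u⁻¹ : (GaussianInt)ˣ) := by rw [← hu, Units.mul_inv_cancel_right]
        convert dvd_sub h (hℓ2.mul_right ((u⁻¹ : (GaussianInt)ˣ) : GaussianInt)) using 1
        linear_combination -h3
      rw [show π = ℓ * (u⁻¹ : (GaussianInt)ˣ) by rw [← hu, Units.mul_inv_cancel_right]]
      exact mul _ _ hℓ2 h1 (inert ℓ hℓ h4) (hunit _ (Units.isUnit _) h1)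
    · exact split π ℓ hπ h hℓ h4 hN
  -- The prime split off by the induction need not be ≡ 1 (mod 2), so the claim is generalised to
  -- every normalised associate of every odd element.
  suffices ∀ α : GaussianInt, IsCoprime α 2 → ∀ β, Associated α β → 2 ∣ β - 1 → P β from
    this α (isCoprime_two_of_dvd_sub_one hα) α (Associated.refl α) hα
  intro α
  induction α using UniqueFactorizationMonoid.induction_on_prime with
  | h₁ => exact fun h => absurd rfl (ne_zero_of_isCoprime_two h)
  | h₂ u hu => exact fun _ β hβ h => hunit β (hβ.isUnit hu) h
  | h₃ α π hα hπ ih =>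
    intro hc β hβ h
    rw [IsCoprime.mul_left_iff] at hc
    obtain ⟨π', hπ', h1⟩ := exists_associated_two_dvd_sub_one hc.1
    obtain ⟨γ, rfl⟩ : π' ∣ β := hπ'.symm.dvd.trans ((dvd_mul_right _ _).trans hβ.dvd)
    have hγ : 2 ∣ γ - 1 := by
      convert dvd_sub h (h1.mul_right γ) using 1
      ring
    refine mul _ _ h1 hγ (hprime _ (hπ'.prime hπ) h1) (ih hc.2 γ ?_ hγ)
    exact (hβ.trans (hπ'.symm.mul_right γ)).of_mul_left (Associated.refl π) hπ.ne_zero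

/-! ### Symbols between rational integers, and the symbol of i -/

theorem isCoprime_intCast {a b : ℤ} (h : IsCoprime a b) :
    IsCoprime (a : GaussianInt) (b : GaussianInt) := by
  simpa using h.map (Int.castRingHom GaussianInt)

theorem isCoprime_natCast_two {n : ℕ} (h : n % 2 = 1) : IsCoprime (n : GaussianInt) 2 :=
  isCoprime_two_of_dvd_sub_one (two_dvd_sub_one_iff.2 (by simp; omega))

theorem not_dvd_two_of_isCoprime {π : GaussianInt} (hπ : Prime π) (h : IsCoprime π 2) : ¬ π ∣ 2 :=
  fun hd => hπ.not_isUnit (h.isUnit_of_dvd' dvd_rfl hd)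

theorem isCoprime_two_of_prime {π : GaussianInt} (hπ : Prime π) (h : ¬ π ∣ 2) : IsCoprime π 2 :=
  isCoprime_of_prime hπ h

theorem prime_of_norm_eq_natPrime {p : ℕ} (hp : p.Prime) {π : GaussianInt} (hN : π.norm = p) :
    Prime π := by
  rw [← irreducible_iff_prime]
  refine ⟨fun hu => ?_, fun x y hxy => ?_⟩
  · rw [← Zsqrtd.norm_eq_one_iff, hN, Int.natAbs_natCast] at hu
    exact hp.one_lt.ne' hu
  · rw [← Zsqrtd.norm_eq_one_iff, ← Zsqrtd.norm_eq_one_iff]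
    have h1 : x.norm.natAbs * y.norm.natAbs = p := by
      rw [← Int.natAbs_mul, ← Zsqrtd.norm_mul, ← hxy, hN, Int.natAbs_natCast]
    rcases (Nat.prime_mul_iff.1 (h1 ▸ hp)) with h | h
    · exact Or.inr h.2
    · exact Or.inl h.2

/-- A rational prime congruent to `1` modulo `4` is a product of two conjugate Gaussian primes. -/
theorem exists_prime_mul_star_eq {ℓ : ℕ} (hℓ : ℓ.Prime) (h : ℓ % 4 = 1) :
    ∃ π : GaussianInt, Prime π ∧ ¬ π ∣ 2 ∧ π.norm = ℓ ∧ (ℓ : GaussianInt) = π * star π := by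
  have hF := Fact.mk hℓ
  obtain ⟨a, b, hab⟩ := Nat.Prime.sq_add_sq (p := ℓ) (by omega)
  have hN : (⟨a, b⟩ : GaussianInt).norm = ℓ := by
    rw [norm_eq, ← hab]; push_cast; rfl
  have hc : IsCoprime (⟨a, b⟩ : GaussianInt) 2 := by
    rw [isCoprime_two_iff, hN]; omega
  have hp := prime_of_norm_eq_natPrime hℓ hN
  refine ⟨_, hp, not_dvd_two_of_isCoprime hp hc, hN, ?_⟩
  rw [← Zsqrtd.norm_eq_mul_conj, hN]; simp

/-- Conjugation moves the symbol modulo π̄ to one modulo π. For rational α the two factors are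
conjugate, so their product is 1. -/
theorem quarticSymbol_natPrime_split (α : GaussianInt) {π : GaussianInt} (hπ : Prime π)
    (h2 : ¬ π ∣ 2) : quarticSymbol α (π * star π) =
      primeQuarticSymbol α π * star (primeQuarticSymbol (star α) π) := by
  have h := isCoprime_two_of_prime hπ h2
  have h' := isCoprime_two_of_prime (prime_star hπ) (not_star_dvd_two h2)
  rw [quarticSymbol_mul_right α h h', quarticSymbol_of_prime hπ h2,
    quarticSymbol_of_prime (prime_star hπ) (not_star_dvd_two h2), ← primeQuarticSymbol_star hπ h2,
    star_star]

/-- A nonzero rational integer is a quartic residue modulo a coprime odd integer. -/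
theorem quarticSymbol_intCast_natCast {a : ℤ} {n : ℕ} (hn : n % 2 = 1) (h : IsCoprime a n) :
    quarticSymbol (a : GaussianInt) (n : GaussianInt) = 1 := by
  induction n using Nat.recOnMul with
  | zero => simp at hn
  | one => rw [Nat.cast_one, quarticSymbol_one_right]
  | prime ℓ hℓ =>
    have ha : ¬ (ℓ : ℤ) ∣ a := fun hd => by
      have := h.isUnit_of_dvd' hd dvd_rfl
      rw [Int.isUnit_iff_natAbs_eq, Int.natAbs_natCast] at this
      exact hℓ.one_lt.ne' this
    have hF := Fact.mk hℓ
    have ha' : (ℓ : GaussianInt) ∣ (a : GaussianInt) ^ (ℓ - 1) - 1 := by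
      have h1 : (ℓ : ℤ) ∣ a ^ (ℓ - 1) - 1 := by
        rw [← ZMod.intCast_zmod_eq_zero_iff_dvd]
        push_cast
        rw [ZMod.pow_card_sub_one_eq_one, sub_self]
        rwa [ne_eq, ZMod.intCast_zmod_eq_zero_iff_dvd]
      exact_mod_cast (Int.cast_dvd_cast (α := GaussianInt) _ _ h1)
    rcases (show ℓ % 4 = 1 ∨ ℓ % 4 = 3 by omega) with h4 | h4
    · obtain ⟨π, hπ, h2, hN, hππ⟩ := exists_prime_mul_star_eq hℓ h4
      have hc : IsCoprime (a : GaussianInt) π := by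
        have := isCoprime_intCast h
        rw [Int.cast_natCast, hππ] at this
        exact this.of_mul_right_left
      rw [hππ, quarticSymbol_natPrime_split _ hπ h2, star_intCast]
      exact mul_star_of_pow_four (primeQuarticSymbol_spec hπ h2
        (fun hd => hπ.not_isUnit (hc.isUnit_of_dvd' hd dvd_rfl))).1
    · have hp := GaussianInt.prime_of_nat_prime_of_mod_four_eq_three ℓ h4
      have h2 := not_dvd_two_of_isCoprime hp (isCoprime_natCast_two hn)
      rw [quarticSymbol_of_prime hp h2]
      refine primeQuarticSymbol_eq hp h2 (one_pow 4) ?_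
      -- For inert ℓ the exponent (ℓ² - 1)/4 is a multiple of ℓ - 1, so Fermat's theorem in ℤ
      -- suffices.
      have hk : (ℓ : GaussianInt).norm.natAbs / 4 = (ℓ - 1) * ((ℓ + 1) / 4) := by
        rw [Zsqrtd.norm_natCast, Int.natAbs_mul, Int.natAbs_natCast]
        obtain ⟨k, rfl⟩ : ∃ k, ℓ = 4 * k + 3 := ⟨ℓ / 4, by omega⟩
        rw [show 4 * k + 3 + 1 = 4 * (k + 1) by ring, Nat.mul_div_cancel_left _ (by norm_num),
          show (4 * k + 3) * (4 * k + 3) = 1 + 4 * ((4 * k + 2) * (k + 1)) by ring,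
          Nat.add_mul_div_left _ _ (by norm_num)]
        simp
      rw [hk, pow_mul]
      exact ha'.trans (by simpa using sub_dvd_pow_sub_pow ((a : GaussianInt) ^ (ℓ - 1)) 1 _)
  | mul m k ihm ihk =>
    rw [Nat.mul_mod] at hn
    have hm : m % 2 = 1 := by
      rcases Nat.mod_two_eq_zero_or_one m with h | h
      · simp [h] at hn
      · exact h
    have hk : k % 2 = 1 := by
      rcases Nat.mod_two_eq_zero_or_one k with h | h
      · simp [h] at hn
      · exact h
    rw [Nat.cast_mul] at h
    rw [Nat.cast_mul, quarticSymbol_mul_right _ (isCoprime_natCast_two hm)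
      (isCoprime_natCast_two hk), ihm hm h.of_mul_right_left, ihk hk h.of_mul_right_right, mul_one]

theorem norm_emod_four_of_two_dvd_sub_one {ω : GaussianInt} (h : 2 ∣ ω - 1) :
    ω.norm % 4 = 1 := by
  obtain ⟨h1, h2⟩ := two_dvd_sub_one_iff.1 h
  obtain ⟨a, ha⟩ : ∃ a, ω.re = 2 * a + 1 := ⟨ω.re / 2, by omega⟩
  obtain ⟨b, hb⟩ : ∃ b, ω.im = 2 * b := ⟨ω.im / 2, by omega⟩
  rw [norm_eq, ha, hb]
  ring_nf
  omega

/-- The supplementary law for the imaginary unit. -/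
theorem quarticSymbol_imagUnit {ω : GaussianInt} (h : 2 ∣ ω - 1) :
    quarticSymbol imagUnit ω = imagUnit ^ (ω.norm.natAbs / 4) := by
  have prime (π : GaussianInt) (hπ : Prime π) (h : IsCoprime π 2) :
      quarticSymbol imagUnit π = imagUnit ^ (π.norm.natAbs / 4) := by
    have h2 := not_dvd_two_of_isCoprime hπ h
    rw [quarticSymbol_of_prime hπ h2]
    refine primeQuarticSymbol_eq hπ h2 ?_ (by rw [sub_self]; exact dvd_zero π)
    rw [← pow_mul, mul_comm, pow_mul, imagUnit_pow_four, one_pow]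
  refine induction_of_two_dvd_sub_one
    (P := fun ω => quarticSymbol imagUnit ω = imagUnit ^ (ω.norm.natAbs / 4))
    ?_ ?_ (fun ℓ hℓ h4 => ?_) (fun π _ hπ h _ _ _ => prime π hπ (isCoprime_two_of_dvd_sub_one h))
    (fun α β hα hβ ihα ihβ => ?_) h
  · rw [quarticSymbol_one_right]; rfl
  · rw [quarticSymbol_of_isUnit _ isUnit_one.neg]; rfl
  · have hF := Fact.mk hℓ
    exact prime _ (GaussianInt.prime_of_nat_prime_of_mod_four_eq_three ℓ h4)
      (isCoprime_natCast_two (by omega))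
  · rw [quarticSymbol_mul_right _ (isCoprime_two_of_dvd_sub_one hα)
      (isCoprime_two_of_dvd_sub_one hβ), ihα, ihβ, ← pow_add, Zsqrtd.norm_mul, Int.natAbs_mul]
    have h1 := norm_emod_four_of_two_dvd_sub_one hα
    have h2 := norm_emod_four_of_two_dvd_sub_one hβ
    obtain ⟨a, ha⟩ : ∃ a, α.norm.natAbs = 4 * a + 1 :=
      ⟨α.norm.natAbs / 4, by have := GaussianInt.norm_nonneg α; omega⟩
    obtain ⟨b, hb⟩ : ∃ b, β.norm.natAbs = 4 * b + 1 :=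
      ⟨β.norm.natAbs / 4, by have := GaussianInt.norm_nonneg β; omega⟩
    -- For norms 4a + 1 and 4b + 1 the exponent of the product is a + b + 4ab, which agrees with a +
    -- b modulo 4.
    rw [ha, hb, show (4 * a + 1) * (4 * b + 1) = 1 + 4 * (4 * (a * b) + a + b) by ring,
      Nat.add_mul_div_left _ _ (by norm_num), add_comm (4 * a), add_comm (4 * b),
      Nat.add_mul_div_left _ _ (by norm_num), Nat.add_mul_div_left _ _ (by norm_num)]
    simp only [Nat.reduceDiv, zero_add]
    rw [add_assoc, pow_add _ (4 * (a * b)), pow_mul, imagUnit_pow_four, one_pow, one_mul]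

/-! ### The quartic character modulo a split prime and its Jacobi sum -/

section residueChar

variable {p : ℕ} [Fact p.Prime] {π : GaussianInt} (hπ : Prime π) (h2 : ¬ π ∣ 2) (hN : π.norm = p)

theorem dvd_natCast_of_norm_eq {n : ℕ} {π : GaussianInt} (hN : π.norm = n) :
    π ∣ (n : GaussianInt) :=
  ⟨star π, by rw [← Zsqrtd.norm_eq_mul_conj, hN, Int.cast_natCast]⟩

theorem dvd_intCast_iff_of_norm_eq {p : ℕ} (hp : p.Prime) {π : GaussianInt} (hN : π.norm = p)
    (a : ℤ) : π ∣ (a : GaussianInt) ↔ (p : ℤ) ∣ a := by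
  constructor
  · rintro ⟨τ, hτ⟩
    have h : (p : ℤ) ∣ a * a := ⟨τ.norm, by rw [← hN, ← Zsqrtd.norm_mul, ← hτ, Zsqrtd.norm_intCast]⟩
    exact (Nat.prime_iff_prime_int.1 hp).dvd_of_dvd_pow (n := 2) (by rwa [sq])
  · rintro ⟨b, rfl⟩
    push_cast
    exact (dvd_natCast_of_norm_eq hN).mul_right _

include hN in
theorem dvd_intCast_sub_of_cast_eq {a b : ℤ} (h : (a : ZMod p) = b) :
    π ∣ (a : GaussianInt) - (b : GaussianInt) := by
  rw [← Int.cast_sub, dvd_intCast_iff_of_norm_eq Fact.out hN, ← ZMod.intCast_zmod_eq_zero_iff_dvd]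
  rw [Int.cast_sub, h, sub_self]

/-- The quartic residue character modulo a Gaussian prime of norm `p`, as a character of
`ZMod p`. -/
noncomputable def quarticChar : MulChar (ZMod p) GaussianInt where
  toFun a := primeQuarticSymbol ((a.val : ℤ) : GaussianInt) π
  map_one' := by
    rw [primeQuarticSymbol_congr hπ h2 (β := 1), primeQuarticSymbol_one hπ h2]
    have := dvd_intCast_sub_of_cast_eq hN (a := ((1 : ZMod p).val : ℤ)) (b := 1) (by simp)
    simpa using this
  map_mul' a b := by
    rw [← primeQuarticSymbol_mul hπ h2, ← Int.cast_mul]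
    exact primeQuarticSymbol_congr hπ h2 (dvd_intCast_sub_of_cast_eq hN (by simp))
  map_nonunit' a ha := by
    apply primeQuarticSymbol_of_dvd hπ h2
    rw [isUnit_iff_ne_zero, not_not] at ha
    rw [ha]
    simp

theorem quarticChar_intCast (a : ℤ) :
    quarticChar hπ h2 hN (a : ZMod p) = primeQuarticSymbol (a : GaussianInt) π :=
  primeQuarticSymbol_congr hπ h2 (dvd_intCast_sub_of_cast_eq hN (by simp))

theorem quarticChar_pow_four : quarticChar hπ h2 hN ^ 4 = 1 := by
  refine MulChar.ext fun a => ?_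
  have h := (primeQuarticSymbol_spec hπ h2 (α := (((a : ZMod p).val : ℤ) : GaussianInt)) ?_).1
  · rw [MulChar.pow_apply_coe, MulChar.one_apply_coe]
    exact h
  · rw [dvd_intCast_iff_of_norm_eq Fact.out hN, ← ZMod.intCast_zmod_eq_zero_iff_dvd]
    simp

/-- Euler's criterion for the quartic character. -/
theorem dvd_pow_sub_quarticChar (a : ℤ) :
    π ∣ (a : GaussianInt) ^ (p / 4) - quarticChar hπ h2 hN (a : ZMod p) := by
  rw [quarticChar_intCast]
  have hN' : π.norm.natAbs = p := by rw [hN, Int.natAbs_natCast]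
  by_cases ha : π ∣ (a : GaussianInt)
  · rw [primeQuarticSymbol_of_dvd hπ h2 ha, sub_zero]
    refine ha.trans (dvd_pow_self _ ?_)
    have h1 := natAbs_norm_mod_four_of_prime hπ h2
    have h3 := (Fact.out : p.Prime).one_lt
    omega
  · have := (primeQuarticSymbol_spec hπ h2 ha).2
    rwa [hN'] at this

theorem dvd_val_pow_sub_quarticChar (a : ZMod p) :
    π ∣ ((a.val : ℤ) : GaussianInt) ^ (p / 4) - quarticChar hπ h2 hN a := by
  have h := dvd_pow_sub_quarticChar hπ h2 hN (a.val : ℤ)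
  rwa [show ((a.val : ℤ) : ZMod p) = a by simp] at h

/-- Take a generator g of (ZMod p)ˣ. Its value is a fourth root of unity; if the square of that
value were 1, Euler's criterion would give g^((p-1)/2) = 1, against the order of g. -/
theorem exists_quarticChar_sq_eq_neg_one : ∃ a, quarticChar hπ h2 hN a ^ 2 = -1 := by
  obtain ⟨g, hg⟩ := IsCyclic.exists_ofOrder_eq_natCard (α := (ZMod p)ˣ)
  have h4 : quarticChar hπ h2 hN g ^ 4 = 1 := by
    rw [← MulChar.pow_apply_coe, quarticChar_pow_four, MulChar.one_apply_coe]
  have h1 : (quarticChar hπ h2 hN g ^ 2 - 1) * (quarticChar hπ h2 hN g ^ 2 + 1) = 0 := by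
    linear_combination h4
  refine ⟨g, (mul_eq_zero.1 h1).elim (fun h => ?_) eq_neg_of_add_eq_zero_left⟩
  exfalso
  have hp4 : p % 4 = 1 := by
    have := natAbs_norm_mod_four_of_prime hπ h2
    rwa [hN, Int.natAbs_natCast] at this
  have h3 := dvd_val_pow_sub_quarticChar hπ h2 hN g
  have h5 : π ∣ ((((g : ZMod p).val : ℤ) ^ (p / 2) - 1 : ℤ) : GaussianInt) := by
    have h6 := h3.trans (sub_dvd_pow_sub_pow _ _ 2)
    rw [← pow_mul, show p / 4 * 2 = p / 2 by omega] at h6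
    rw [sub_eq_zero.1 h] at h6
    push_cast
    exact_mod_cast h6
  rw [dvd_intCast_iff_of_norm_eq Fact.out hN, ← ZMod.intCast_zmod_eq_zero_iff_dvd] at h5
  have h6 : g ^ (p / 2) = 1 := by
    ext
    push_cast at h5 ⊢
    simpa [sub_eq_zero] using h5
  have h7 := orderOf_dvd_of_pow_eq_one h6
  rw [hg, Nat.card_eq_fintype_card, ZMod.card_units p] at h7
  have := (Fact.out : p.Prime).one_lt
  have := Nat.le_of_dvd (by omega) h7
  omega

theorem quarticChar_sq_ne_one : quarticChar hπ h2 hN ^ 2 ≠ 1 := by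
  obtain ⟨a, ha⟩ := exists_quarticChar_sq_eq_neg_one hπ h2 hN
  intro h
  by_cases hu : IsUnit a
  · obtain ⟨a, rfl⟩ := hu
    rw [← MulChar.pow_apply_coe, h, MulChar.one_apply_coe] at ha
    exact absurd ha (by decide)
  · rw [MulChar.map_nonunit _ hu] at ha
    exact absurd ha (by decide)

theorem quarticChar_ne_one : quarticChar hπ h2 hN ≠ 1 := fun h =>
  quarticChar_sq_ne_one hπ h2 hN (by rw [h, one_pow])

/-- By Euler's criterion the Jacobi sum is congruent modulo π to the sum of a^k(1-a)^k over 𝔽_p,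
with k = (p-1)/4. This polynomial has degree below p - 1, so the sum vanishes. -/
theorem dvd_jacobiSum_quarticChar :
    π ∣ jacobiSum (quarticChar hπ h2 hN) (quarticChar hπ h2 hN) := by
  have hp4 : p % 4 = 1 := by
    have := natAbs_norm_mod_four_of_prime hπ h2
    rwa [hN, Int.natAbs_natCast] at this
  set q := Ideal.Quotient.mk (Ideal.span {π})
  have hq (α : GaussianInt) : q α = 0 ↔ π ∣ α := by
    rw [Ideal.Quotient.eq_zero_iff_mem, Ideal.mem_span_singleton]
  have h (a : ZMod p) : q (quarticChar hπ h2 hN a) = q ((((a.val : ℤ) : ℤ) ^ (p / 4) : ℤ)) := by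
    have := dvd_val_pow_sub_quarticChar hπ h2 hN a
    rw [← hq, map_sub, sub_eq_zero] at this
    rw [← this, Int.cast_pow]
  rw [← hq, jacobiSum, map_sum]
  simp_rw [map_mul, h, ← map_mul, ← map_sum, ← Int.cast_mul]
  rw [hq, ← Int.cast_sum, dvd_intCast_iff_of_norm_eq Fact.out hN,
    ← ZMod.intCast_zmod_eq_zero_iff_dvd]
  push_cast
  simp only [ZMod.natCast_val, ZMod.cast_id', id]
  let P : Polynomial (ZMod p) := Polynomial.X ^ (p / 4) * (1 - Polynomial.X) ^ (p / 4)
  have hP : P.natDegree < p - 1 := by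
    have h1 : P.natDegree ≤ p / 4 + p / 4 := by
      refine Polynomial.natDegree_mul_le_of_le (Polynomial.natDegree_X_pow_le _) ?_
      refine Polynomial.natDegree_pow_le.trans (by
        refine (Nat.mul_le_mul_left _ (?_ : _ ≤ 1)).trans (mul_one _).le
        exact (Polynomial.natDegree_sub_le _ _).trans (by simp))
    have := (Fact.out : p.Prime).one_lt
    omega
  have h1 (x : ZMod p) : x ^ (p / 4) * (1 - x) ^ (p / 4) = P.eval x := by simp [P]
  simp_rw [h1, Polynomial.eval_eq_sum_range' hP]
  rw [Finset.sum_comm]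
  refine Finset.sum_eq_zero fun i hi => ?_
  rw [← Finset.mul_sum, FiniteField.sum_pow_lt_card_sub_one, mul_zero]
  rw [ZMod.card]
  exact Finset.mem_range.1 hi

/-- The inverse character is the conjugate one, so the norm is J(χ,χ)J(χ⁻¹,χ⁻¹), which equals p
since χ and χ² are nontrivial. The product formula is applied after embedding into ℂ. -/
theorem norm_jacobiSum_quarticChar :
    (jacobiSum (quarticChar hπ h2 hN) (quarticChar hπ h2 hN)).norm = p := by
  set χ := quarticChar hπ h2 hN with hχ
  have hinv : (χ.ringHomComp toComplex)⁻¹ = (χ⁻¹).ringHomComp toComplex :=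
    MulChar.ringHomComp_inv χ toComplex
  have hne : χ.ringHomComp toComplex ≠ 1 :=
    (MulChar.ringHomComp_ne_one_iff toComplex_injective).2 (quarticChar_ne_one hπ h2 hN)
  have hne2 : χ.ringHomComp toComplex * χ.ringHomComp toComplex ≠ 1 := by
    rw [← MulChar.ringHomComp_mul]
    refine (MulChar.ringHomComp_ne_one_iff toComplex_injective).2 ?_
    rw [← sq]
    exact quarticChar_sq_ne_one hπ h2 hN
  have h := jacobiSum_mul_jacobiSum_inv (F' := ℂ) (F := ZMod p) ?_ hne hne hne2
  · rw [hinv, jacobiSum_ringHomComp, jacobiSum_ringHomComp, ZMod.card] at h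
    have hstar : jacobiSum χ⁻¹ χ⁻¹ = star (jacobiSum χ χ) := by
      have hs (a : ZMod p) : χ⁻¹ a = star (χ a) := by
        by_cases hu : IsUnit a
        · obtain ⟨a, rfl⟩ := hu
          have h4 : χ a ^ 4 = 1 := by
            rw [← MulChar.pow_apply_coe, quarticChar_pow_four, MulChar.one_apply_coe]
          have h5 : χ⁻¹ a * χ a = 1 := by
            rw [← MulChar.mul_apply, inv_mul_cancel, MulChar.one_apply_coe]
          have h6 := mul_star_of_pow_four h4
          linear_combination star (χ a) * h5 - χ⁻¹ a * h6
        · rw [MulChar.map_nonunit _ hu, MulChar.map_nonunit _ hu, star_zero]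
      rw [jacobiSum, jacobiSum, star_sum]
      exact Finset.sum_congr rfl fun x _ => by rw [hs, hs, star_mul, mul_comm]
    rw [hstar, ← map_mul, ← Zsqrtd.norm_eq_mul_conj, map_intCast] at h
    exact_mod_cast h
  · rw [ringChar.eq_zero, ZMod.ringChar_zmod_n]
    exact (Fact.out : p.Prime).ne_zero.symm

theorem two_dvd_jacobiSum_quarticChar_sub_one :
    2 ∣ jacobiSum (quarticChar hπ h2 hN) (quarticChar hπ h2 hN) - 1 := by
  have hp4 : p % 4 = 1 := by
    have := natAbs_norm_mod_four_of_prime hπ h2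
    rwa [hN, Int.natAbs_natCast] at this
  have hprim : IsPrimitiveRoot imagUnit 4 := by
    rw [IsPrimitiveRoot.iff (by norm_num)]
    refine ⟨imagUnit_pow_four, fun k hk hk4 => ?_⟩
    interval_cases k <;> decide
  obtain ⟨z, -, hz⟩ := exists_jacobiSum_eq_neg_one_add (by norm_num)
    (quarticChar_pow_four hπ h2 hN) (quarticChar_pow_four hπ h2 hN)
    (by rw [ZMod.card]; omega) hprim
  rw [hz]
  exact ⟨-1 - z * imagUnit, by linear_combination z * imagUnit_sq⟩

/-- The Jacobi sum is divisible by π and has the same norm, so it is a unit times π. Both are ≡ 1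
(mod 2), so the unit is ±1, and squaring removes the sign. -/
theorem jacobiSum_quarticChar_sq (hprimary : 2 ∣ π - 1) :
    jacobiSum (quarticChar hπ h2 hN) (quarticChar hπ h2 hN) ^ 2 = π ^ 2 := by
  obtain ⟨u, hu⟩ := dvd_jacobiSum_quarticChar hπ h2 hN
  have hnorm := norm_jacobiSum_quarticChar hπ h2 hN
  have hone := two_dvd_jacobiSum_quarticChar_sub_one hπ h2 hN
  rw [hu] at hone hnorm ⊢
  have h1 : IsUnit u := by
    rw [← Zsqrtd.norm_eq_one_iff' (by norm_num)]
    rw [Zsqrtd.norm_mul, hN] at hnorm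
    exact mul_left_cancel₀ (by exact_mod_cast (Fact.out : p.Prime).ne_zero) (hnorm.trans (mul_one _).symm)
  have h3 : 2 ∣ u - 1 := by
    convert dvd_sub hone (hprimary.mul_right u) using 1
    ring
  rcases eq_one_or_neg_one_of_isUnit h1 h3 with rfl | rfl <;> ring

/-! ### Quartic Gauss sums and reciprocity with a rational prime -/

section gauss

variable {K : Type*} [Field K] (φ : GaussianInt →+* K) {ψ : AddChar (ZMod p) K}
  (hψ : ψ.IsPrimitive) (hK2 : (2 : K) ≠ 0)
include hψ hK2

/-- From G(χ)² = J(χ,χ)G(χ²), with χ² quadratic and χ²(-1) = 1, one gets G(χ²)² = p and G(χ)⁴ =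
pJ(χ,χ)². -/
theorem gaussSum_quarticChar_pow_four (hprimary : 2 ∣ π - 1) :
    gaussSum ((quarticChar hπ h2 hN).ringHomComp φ) ψ ^ 4 = p * φ π ^ 2 := by
  set χ := (quarticChar hπ h2 hN).ringHomComp φ with hχ
  have hχ4 : χ ^ 4 = 1 := by
    rw [hχ, MulChar.ringHomComp_pow, quarticChar_pow_four, MulChar.ringHomComp_one]
  have hsq : χ * χ ≠ 1 := by
    obtain ⟨a, ha⟩ := exists_quarticChar_sq_eq_neg_one hπ h2 hN
    intro h
    have hu : IsUnit a := by
      by_contra hu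
      rw [MulChar.map_nonunit _ hu] at ha
      exact absurd ha (by decide)
    have h1 : (χ * χ) a = -1 := by
      rw [MulChar.mul_apply, ← sq, hχ, MulChar.ringHomComp_apply, ← map_pow, ha, map_neg, map_one]
    rw [h, MulChar.one_apply hu] at h1
    exact hK2 (by linear_combination h1)
  have h1 := jacobiSum_mul_nontrivial hsq ψ
  have hquad : (χ * χ).IsQuadratic := by
    intro a
    by_cases hu : IsUnit a
    · right
      have h : ((χ * χ) a - 1) * ((χ * χ) a + 1) = 0 := by
        have h3 : (χ ^ 4) a = 1 := by rw [hχ4, MulChar.one_apply hu]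
        rw [show 4 = 2 + 2 by norm_num, pow_add, sq, MulChar.mul_apply] at h3
        linear_combination h3
      exact (mul_eq_zero.1 h).imp sub_eq_zero.1 eq_neg_of_add_eq_zero_left
    · exact Or.inl (MulChar.map_nonunit _ hu)
  have h3 := gaussSum_sq hsq hquad hψ
  have h4 : (χ * χ) (-1) = 1 := by
    rw [MulChar.mul_apply, ← map_mul]
    simp
  have h5 : jacobiSum χ χ ^ 2 = φ π ^ 2 := by
    rw [hχ, jacobiSum_ringHomComp, ← map_pow, jacobiSum_quarticChar_sq hπ h2 hN hprimary, map_pow]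
  rw [h4, one_mul, ZMod.card] at h3
  calc gaussSum χ ψ ^ 4 = (gaussSum χ ψ * gaussSum χ ψ) ^ 2 := by ring
    _ = gaussSum (χ * χ) ψ ^ 2 * jacobiSum χ χ ^ 2 := by rw [← h1, mul_pow]
    _ = p * φ π ^ 2 := by rw [h3, h5]

variable {ℓ : ℕ} [Fact ℓ.Prime] [CharP K ℓ] (hℓp : ℓ ≠ p)
include hℓp

omit hψ hK2 in
theorem isUnit_natCast_of_prime_ne : IsUnit (ℓ : ZMod p) := by
  rw [isUnit_iff_ne_zero, ne_eq, ZMod.natCast_eq_zero_iff,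
    Nat.prime_dvd_prime_iff_eq Fact.out Fact.out]
  exact hℓp.symm

omit hψ hK2 in
theorem natCast_ne_zero_of_prime_ne : (p : K) ≠ 0 := by
  rw [ne_eq, CharP.cast_eq_zero_iff K ℓ, Nat.prime_dvd_prime_iff_eq Fact.out Fact.out]
  exact hℓp

omit hψ hK2 hℓp in
theorem gaussSum_pow_char_mul (χ : MulChar (ZMod p) K) (hℓ : IsUnit (ℓ : ZMod p)) :
    (χ ^ ℓ) ℓ * gaussSum χ ψ ^ ℓ = gaussSum (χ ^ ℓ) ψ := by
  rw [gaussSum_frob, AddChar.pow_mulShift]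
  have := gaussSum_mulShift (χ ^ ℓ) ψ hℓ.unit
  rwa [hℓ.unit_spec] at this

/-- Here χ^ℓ = χ, so Frobenius gives χ(ℓ)G^ℓ = G. Cancel G, which is nonzero because p ≠ 0 in K, and
write G^(ℓ-1) as a power of G⁴. -/
theorem quarticChar_mul_pow_eq_one (hprimary : 2 ∣ π - 1) (h4 : ℓ % 4 = 1) :
    φ (quarticChar hπ h2 hN ℓ) * (p * φ π ^ 2) ^ (ℓ / 4) = 1 := by
  have hχ : (quarticChar hπ h2 hN).ringHomComp φ ^ ℓ = (quarticChar hπ h2 hN).ringHomComp φ := by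
    rw [MulChar.ringHomComp_pow]
    conv_lhs => rw [← Nat.div_add_mod ℓ 4, h4, pow_add, pow_mul, quarticChar_pow_four]
    simp
  have h := gaussSum_pow_char_mul (ψ := ψ) ((quarticChar hπ h2 hN).ringHomComp φ)
    (isUnit_natCast_of_prime_ne hℓp)
  have hG4 := gaussSum_quarticChar_pow_four hπ h2 hN φ hψ hK2 hprimary
  rw [hχ] at h
  have hG : gaussSum ((quarticChar hπ h2 hN).ringHomComp φ) ψ ≠ 0 := by
    apply gaussSum_ne_zero_of_nontrivial _ _ hψ
    · rw [ZMod.card]; exact natCast_ne_zero_of_prime_ne hℓp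
    · intro h1
      obtain ⟨a, ha⟩ := exists_quarticChar_sq_eq_neg_one hπ h2 hN
      have hu : IsUnit a := by
        by_contra hu
        rw [MulChar.map_nonunit _ hu] at ha
        exact absurd ha (by decide)
      have h3 := congrArg φ ha
      rw [map_pow, ← MulChar.ringHomComp_apply, h1, MulChar.one_apply hu, map_neg, map_one] at h3
      exact hK2 (by linear_combination h3)
  apply mul_right_cancel₀ hG
  rw [one_mul, ← hG4, ← pow_mul, mul_assoc, ← pow_succ, ← MulChar.ringHomComp_apply,
    show 4 * (ℓ / 4) + 1 = ℓ by omega]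
  exact h

/-- Here χ^ℓ = χ⁻¹, so Frobenius gives G^ℓ = χ(ℓ)G(χ⁻¹). Multiply by G and use G(χ)G(χ⁻¹) = χ(-1)p;
this is where -ℓ replaces ℓ. -/
theorem pow_eq_quarticChar_mul (hprimary : 2 ∣ π - 1) (h4 : ℓ % 4 = 3) :
    (p * φ π ^ 2) ^ (ℓ / 4 + 1) = φ (quarticChar hπ h2 hN (-ℓ)) * p := by
  set χ := (quarticChar hπ h2 hN).ringHomComp φ with hχdef
  have hχ4 : χ ^ 4 = 1 := by
    rw [hχdef, MulChar.ringHomComp_pow, quarticChar_pow_four, MulChar.ringHomComp_one]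
  have hχ : χ ^ ℓ = χ⁻¹ := by
    rw [eq_inv_iff_mul_eq_one, ← pow_succ, show ℓ + 1 = 4 * (ℓ / 4 + 1) by omega, pow_mul, hχ4,
      one_pow]
  have hℓu := isUnit_natCast_of_prime_ne hℓp
  have h := gaussSum_pow_char_mul (ψ := ψ) χ hℓu
  have hG4 := gaussSum_quarticChar_pow_four hπ h2 hN φ hψ hK2 hprimary
  rw [hχ] at h
  have hne : χ ≠ 1 := by
    intro h1
    obtain ⟨a, ha⟩ := exists_quarticChar_sq_eq_neg_one hπ h2 hN
    have hu : IsUnit a := by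
      by_contra hu
      rw [MulChar.map_nonunit _ hu] at ha
      exact absurd ha (by decide)
    have h3 := congrArg φ ha
    rw [map_pow, ← MulChar.ringHomComp_apply, ← hχdef, h1, MulChar.one_apply hu, map_neg,
      map_one] at h3
    exact hK2 (by linear_combination h3)
  have h5 := gaussSum_mul_gaussSum_eq_card hne hψ
  rw [ZMod.card] at h5
  have h6 := mul_gaussSum_inv_eq_gaussSum χ⁻¹ ψ
  have h7 : χ⁻¹ (-1) = χ (-1) := by
    rw [MulChar.inv_apply', inv_neg_one]
  have h8 : χ ℓ * χ⁻¹ ℓ = 1 := by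
    rw [← MulChar.mul_apply, mul_inv_cancel, MulChar.one_apply hℓu]
  have h9 : φ (quarticChar hπ h2 hN (-ℓ)) = χ (-1) * χ ℓ := by
    rw [← MulChar.ringHomComp_apply, ← hχdef, ← map_mul, neg_one_mul]
  rw [← hG4, ← pow_mul, show 4 * (ℓ / 4 + 1) = ℓ + 1 by omega, h9, pow_succ]
  rw [h7] at h6
  linear_combination χ ℓ * gaussSum χ ψ * h - gaussSum χ ψ ^ ℓ * gaussSum χ ψ * h8
    - χ ℓ * gaussSum χ ψ * h6 + χ ℓ * χ (-1) * h5

end gauss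

/-- Transfer of identities between Gauss sums to a residue ring of `ℤ[i]`. -/
theorem exists_field_with_primitive_addChar {ℓ : ℕ} [Fact ℓ.Prime] (hℓp : ℓ ≠ p)
    {Λ : GaussianInt} (hΛ : Prime Λ) (hΛℓ : Λ ∣ ℓ) :
    ∃ (K : Type) (_ : Field K) (_ : CharP K ℓ) (φ : GaussianInt →+* K) (ψ : AddChar (ZMod p) K),
      ψ.IsPrimitive ∧ ∀ α, φ α = 0 ↔ Λ ∣ α := by
  have hmax : (Ideal.span {Λ}).IsMaximal := PrincipalIdealRing.isMaximal_of_irreducible hΛ.irreducible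
  let _ : Field (GaussianInt ⧸ Ideal.span {Λ}) := Ideal.Quotient.field _
  have hmk (α : GaussianInt) : Ideal.Quotient.mk (Ideal.span {Λ}) α = 0 ↔ Λ ∣ α := by
    rw [Ideal.Quotient.eq_zero_iff_mem, Ideal.mem_span_singleton]
  have hchar : CharP (GaussianInt ⧸ Ideal.span {Λ}) ℓ := by
    rw [← ringChar.eq_iff]
    refine CharP.ringChar_of_prime_eq_zero Fact.out ?_
    rw [← map_natCast (Ideal.Quotient.mk (Ideal.span {Λ})), hmk]
    exact hΛℓ
  have hring : ringChar (GaussianInt ⧸ Ideal.span {Λ}) ≠ ringChar (ZMod p) := by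
    rw [ringChar.eq_iff.2 hchar, ZMod.ringChar_zmod_n]
    exact hℓp
  -- A primitive additive character of ZMod p exists over a cyclotomic extension of the residue
  -- field ℤ[i]/Λ. The Gauss sum thus lives directly in characteristic ℓ.
  let ψ := AddChar.FiniteField.primitiveChar (ZMod p) (GaussianInt ⧸ Ideal.span {Λ}) hring
  refine ⟨CyclotomicField ψ.n (GaussianInt ⧸ Ideal.span {Λ}), inferInstance,
    charP_of_injective_algebraMap (algebraMap (GaussianInt ⧸ Ideal.span {Λ}) _).injective ℓ,
    (algebraMap _ _).comp (Ideal.Quotient.mk (Ideal.span {Λ})), ψ.char, ψ.prim, fun α => ?_⟩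
  rw [RingHom.comp_apply, map_eq_zero, hmk]

include hπ h2 hN

/-- Quartic reciprocity between a split Gaussian prime and a rational prime `ℓ ≡ 1 (mod 4)`. -/
theorem primeQuarticSymbol_natPrime_of_mod_four_eq_one (hprimary : 2 ∣ π - 1) {ℓ : ℕ}
    (hℓ : ℓ.Prime) (hℓp : ℓ ≠ p) (h4 : ℓ % 4 = 1) :
    primeQuarticSymbol ℓ π = quarticSymbol π ℓ := by
  have hF := Fact.mk hℓ
  obtain ⟨Λ, hΛ, hΛ2, hΛN, hΛΛ⟩ := exists_prime_mul_star_eq hℓ h4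
  have hΛN' : Λ.norm.natAbs = ℓ := by rw [hΛN, Int.natAbs_natCast]
  obtain ⟨K, _, _, φ, ψ, hψ, hφ⟩ := exists_field_with_primitive_addChar (p := p) hℓp hΛ
    (dvd_natCast_of_norm_eq hΛN)
  have hK2 : (2 : K) ≠ 0 := by
    rwa [← map_ofNat φ 2, ne_eq, hφ]
  have h := quarticChar_mul_pow_eq_one hπ h2 hN φ hψ hK2 hℓp hprimary h4
  have hcast : quarticChar hπ h2 hN ℓ = primeQuarticSymbol ℓ π := by
    simpa using quarticChar_intCast hπ h2 hN ℓ
  have hpp : (p : GaussianInt) = π * star π := by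
    rw [← Zsqrtd.norm_eq_mul_conj, hN]; simp
  have hΛp : ¬ Λ ∣ (p : GaussianInt) := by
    rw [← Int.cast_natCast, dvd_intCast_iff_of_norm_eq hℓ hΛN, Int.natCast_dvd_natCast,
      Nat.prime_dvd_prime_iff_eq hℓ Fact.out]
    exact hℓp
  have hΛπ : ¬ Λ ∣ π := fun hd => hΛp (hpp ▸ hd.mul_right _)
  have hΛπ' : ¬ Λ ∣ star π := fun hd => hΛp (hpp ▸ hd.mul_left _)
  obtain ⟨s4, hs⟩ := primeQuarticSymbol_spec hΛ hΛ2 hΛπ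
  obtain ⟨t4, ht⟩ := primeQuarticSymbol_spec hΛ hΛ2 hΛπ'
  have hπℓ : ¬ π ∣ (ℓ : GaussianInt) := by
    rw [← Int.cast_natCast, dvd_intCast_iff_of_norm_eq Fact.out hN, Int.natCast_dvd_natCast,
      Nat.prime_dvd_prime_iff_eq Fact.out hℓ]
    exact hℓp.symm
  obtain ⟨c4, -⟩ := primeQuarticSymbol_spec hπ h2 hπℓ
  rw [hΛΛ, quarticSymbol_natPrime_split _ hΛ hΛ2, ← hΛΛ]
  rw [hΛN', ← hφ, map_sub, sub_eq_zero, map_pow] at hs ht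
  rw [hcast, ← map_natCast φ p, hpp, map_mul, mul_pow, mul_pow, pow_right_comm, hs, ht] at h
  set c := primeQuarticSymbol ℓ π
  set s := primeQuarticSymbol π Λ
  set t := primeQuarticSymbol (star π) Λ
  -- Modulo Λ, (pπ²)^((ℓ-1)/4) = (π³π̄)^((ℓ-1)/4) ≡ s³t. Hence c = s·t̄, which is (π/Λ)(π/Λ̄).
  have key : c * (s ^ 3 * t) = 1 := by
    refine eq_of_pow_four_eq_one_of_dvd_sub hΛ hΛ2 ?_ (one_pow 4) ?_
    · rw [mul_pow, mul_pow, ← pow_mul, mul_comm 3 4, pow_mul, s4, t4, c4]; norm_num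
    · rw [← hφ]
      simp only [map_sub, map_mul, map_pow, map_one]
      linear_combination h
  have ht' := mul_star_of_pow_four t4
  linear_combination s * star t * key - c * s4 * t * star t - c * ht'

/-- Quartic reciprocity between a split Gaussian prime and a rational prime `ℓ ≡ 3 (mod 4)`. -/
theorem primeQuarticSymbol_neg_natPrime_of_mod_four_eq_three (hprimary : 2 ∣ π - 1) {ℓ : ℕ}
    (hℓ : ℓ.Prime) (hℓp : ℓ ≠ p) (h4 : ℓ % 4 = 3) :
    primeQuarticSymbol (-ℓ) π = quarticSymbol π ℓ := by
  have hF := Fact.mk hℓ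
  have hΛ := GaussianInt.prime_of_nat_prime_of_mod_four_eq_three ℓ h4
  have hΛ2 := not_dvd_two_of_isCoprime hΛ (isCoprime_natCast_two (by omega))
  obtain ⟨K, _, _, φ, ψ, hψ, hφ⟩ := exists_field_with_primitive_addChar (p := p) hℓp hΛ dvd_rfl
  have hK2 : (2 : K) ≠ 0 := by
    rwa [← map_ofNat φ 2, ne_eq, hφ]
  have h := pow_eq_quarticChar_mul hπ h2 hN φ hψ hK2 hℓp hprimary h4
  have hcast : quarticChar hπ h2 hN (-ℓ) = primeQuarticSymbol (-ℓ) π := by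
    simpa using quarticChar_intCast hπ h2 hN (-ℓ)
  have hpp : (p : GaussianInt) = π * star π := by
    rw [← Zsqrtd.norm_eq_mul_conj, hN]; simp
  have hp0 : φ (p : GaussianInt) ≠ 0 := by
    rw [map_natCast]
    exact natCast_ne_zero_of_prime_ne hℓp
  have hπ0 : φ π ≠ 0 := fun h0 => hp0 (by rw [hpp, map_mul, h0, zero_mul])
  have hπℓ : ¬ π ∣ -(ℓ : GaussianInt) := by
    rw [dvd_neg, ← Int.cast_natCast, dvd_intCast_iff_of_norm_eq Fact.out hN,
      Int.natCast_dvd_natCast, Nat.prime_dvd_prime_iff_eq Fact.out hℓ]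
    exact hℓp.symm
  obtain ⟨c4, -⟩ := primeQuarticSymbol_spec hπ h2 hπℓ
  rw [quarticSymbol_of_prime hΛ hΛ2]
  refine (primeQuarticSymbol_eq hΛ hΛ2 c4 ?_).symm
  have hstar : φ (star π) = φ π ^ ℓ := by
    have := natPrime_dvd_pow_sub_star hℓ h4 π
    rw [← hφ, map_sub, sub_eq_zero, map_pow] at this
    exact this.symm
  rw [← hφ, map_sub, map_pow, sub_eq_zero]
  rw [hcast, ← map_natCast φ p, hpp, map_mul, hstar, ← pow_succ', ← pow_add, ← pow_mul] at h
  -- Since π̄ ≡ π^ℓ, the identity compares powers of π alone, and (ℓ+3)(ℓ+1)/4 - (ℓ+1) = (ℓ²-1)/4 is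
  -- the exponent defining the symbol modulo ℓ.
  apply mul_right_cancel₀ (pow_ne_zero (ℓ + 1) hπ0)
  rw [← h, ← pow_add]
  congr 1
  rw [Zsqrtd.norm_natCast, Int.natAbs_mul, Int.natAbs_natCast]
  obtain ⟨k, rfl⟩ : ∃ k, ℓ = 4 * k + 3 := ⟨ℓ / 4, by omega⟩
  rw [show (4 * k + 3) * (4 * k + 3) = 1 + 4 * ((4 * k + 2) * (k + 1)) by ring,
    Nat.add_mul_div_left _ _ (by norm_num), show (4 * k + 3) / 4 = k by omega]
  simp only [Nat.reduceDiv, zero_add]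
  ring

end residueChar

/-! ### Rational quartic reciprocity and the supplementary laws -/

theorem isCoprime_intCast_two {a : ℤ} (h : a % 2 = 1) : IsCoprime (a : GaussianInt) 2 :=
  isCoprime_two_of_dvd_sub_one (two_dvd_sub_one_iff.2 (by simp; omega))

theorem associated_natAbs (a : ℤ) : Associated (a : GaussianInt) (a.natAbs : GaussianInt) := by
  rcases Int.natAbs_eq a with h | h
  · conv_lhs => rw [h]
    rw [Int.cast_natCast]
  · conv_lhs => rw [h]
    rw [Int.cast_neg, Int.cast_natCast]
    exact (Associated.refl _).neg_left

theorem quarticSymbol_natAbs_right (α : GaussianInt) {a : ℤ} (h : a % 2 = 1) :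
    quarticSymbol α (a.natAbs : GaussianInt) = quarticSymbol α a :=
  (quarticSymbol_associated α (isCoprime_intCast_two h) (associated_natAbs a)).symm

theorem quarticSymbol_intCast_intCast {a b : ℤ} (hb : b % 2 = 1) (h : IsCoprime a b) :
    quarticSymbol (a : GaussianInt) (b : GaussianInt) = 1 := by
  rw [← quarticSymbol_natAbs_right _ hb]
  refine quarticSymbol_intCast_natCast (by omega) ?_
  exact h.of_isCoprime_of_dvd_right (Int.natAbs_dvd.2 dvd_rfl)

theorem quarticSymbol_neg_one_left {ω : GaussianInt} (h : 2 ∣ ω - 1) :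
    quarticSymbol (-1) ω = (-1) ^ (ω.norm.natAbs / 4) := by
  rw [← imagUnit_sq, quarticSymbol_pow_left _ _ (isCoprime_two_of_dvd_sub_one h),
    quarticSymbol_imagUnit h, ← pow_mul, ← pow_mul, mul_comm]

theorem quarticSymbol_neg_left_sq {α ω : GaussianInt} (h : 2 ∣ ω - 1) :
    quarticSymbol (-α) ω ^ 2 = quarticSymbol α ω ^ 2 := by
  rw [neg_eq_neg_one_mul α, quarticSymbol_mul_left _ _ (isCoprime_two_of_dvd_sub_one h),
    quarticSymbol_neg_one_left h, mul_pow, ← pow_mul, mul_comm _ 2, pow_mul]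
  norm_num

open ZMod in
-- The number χ₄(n)n = ±n is multiplicative in n and ≡ 1 (mod 4). It unites the two prime
-- reciprocity laws and extends them to all odd n.
theorem quarticSymbol_χ₄_mul_natCast {π : GaussianInt} {p : ℕ} (hπ : Prime π) (h : 2 ∣ π - 1)
    (hp : p.Prime) (hN : π.norm = p) {n : ℕ} (hn : n % 2 = 1) (hc : IsCoprime (n : GaussianInt) π) :
    quarticSymbol ((χ₄ n * n : ℤ) : GaussianInt) π = quarticSymbol π n := by
  have hF := Fact.mk hp
  have h2 := not_dvd_two_of_isCoprime hπ (isCoprime_two_of_dvd_sub_one h)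
  have h2' := isCoprime_two_of_dvd_sub_one h
  induction n using Nat.recOnMul with
  | zero => simp at hn
  | one => simp [quarticSymbol_one_right, quarticSymbol_one_left h2']
  | prime ℓ hℓ =>
    have hℓp : ℓ ≠ p := by
      rintro rfl
      exact hπ.not_isUnit (hc.isUnit_of_dvd' (dvd_natCast_of_norm_eq hN) dvd_rfl)
    rw [quarticSymbol_of_prime hπ h2]
    rcases (show ℓ % 4 = 1 ∨ ℓ % 4 = 3 by omega) with h4 | h4
    · rw [χ₄_nat_one_mod_four h4, one_mul, Int.cast_natCast]
      exact primeQuarticSymbol_natPrime_of_mod_four_eq_one hπ h2 hN h hℓ hℓp h4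
    · rw [χ₄_nat_three_mod_four h4, neg_one_mul, Int.cast_neg, Int.cast_natCast]
      exact primeQuarticSymbol_neg_natPrime_of_mod_four_eq_three hπ h2 hN h hℓ hℓp h4
  | mul m k ihm ihk =>
    obtain ⟨hm, hk⟩ := Nat.odd_mul.1 (Nat.odd_iff.2 hn)
    rw [Nat.odd_iff] at hm hk
    rw [Nat.cast_mul] at hc
    rw [Nat.cast_mul (α := GaussianInt), quarticSymbol_mul_right _ (isCoprime_natCast_two hm)
      (isCoprime_natCast_two hk), ← ihm hm hc.of_mul_left_left, ← ihk hk hc.of_mul_left_right,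
      ← quarticSymbol_mul_left _ _ h2']
    congr 1
    push_cast
    rw [map_mul]
    push_cast
    ring

/-- Quartic reciprocity between a rational integer and a Gaussian integer. -/
theorem quarticSymbol_intCast_eq {a : ℤ} {ω : GaussianInt} (ha : a % 4 = 1) (hω : 2 ∣ ω - 1)
    (h : IsCoprime (a : GaussianInt) ω) : quarticSymbol a ω = quarticSymbol ω a := by
  have ha2 : a % 2 = 1 := by omega
  refine induction_of_two_dvd_sub_one
    (P := fun ω => IsCoprime (a : GaussianInt) ω → quarticSymbol a ω = quarticSymbol ω a)
    (fun _ => ?_) (fun _ => ?_) (fun ℓ hℓ h4 hc => ?_) (fun π p hπ h2 hp h4 hN hc => ?_)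
    (fun α β hα hβ ihα ihβ hc => ?_) hω h
  · rw [quarticSymbol_one_right, quarticSymbol_one_left (isCoprime_intCast_two ha2)]
  · rw [quarticSymbol_of_isUnit _ isUnit_one.neg]
    have := quarticSymbol_intCast_intCast ha2 (isCoprime_one_left.neg_left : IsCoprime (-1) a)
    simpa using this.symm
  -- For an inert prime both sides are symbols between coprime rational integers, hence 1.
  · have hc' : IsCoprime a ℓ := by
      rw [Int.isCoprime_iff_gcd_eq_one, ← Int.isCoprime_iff_gcd_eq_one, isCoprime_comm,
        (Nat.prime_iff_prime_int.1 hℓ).irreducible.coprime_iff_not_dvd]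
      rintro ⟨b, rfl⟩
      have hF := Fact.mk hℓ
      refine (GaussianInt.prime_of_nat_prime_of_mod_four_eq_three ℓ h4).not_isUnit
        (hc.isUnit_of_dvd' ?_ dvd_rfl)
      push_cast
      exact dvd_mul_right _ _
    rw [quarticSymbol_intCast_natCast (by omega) hc']
    have := quarticSymbol_intCast_intCast ha2 hc'.symm
    rw [Int.cast_natCast] at this
    exact this.symm
  · rw [← quarticSymbol_natAbs_right _ ha2, ← quarticSymbol_χ₄_mul_natCast hπ h2 hp hN (by omega)
      (hc.of_isCoprime_of_dvd_left (associated_natAbs a).symm.dvd)]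
    congr 2
    rcases Int.natAbs_eq a with h | h
    · rw [ZMod.χ₄_nat_one_mod_four (by omega)]; omega
    · rw [ZMod.χ₄_nat_three_mod_four (by omega)]; omega
  · rw [quarticSymbol_mul_right _ (isCoprime_two_of_dvd_sub_one hα)
      (isCoprime_two_of_dvd_sub_one hβ), quarticSymbol_mul_left _ _ (isCoprime_intCast_two ha2),
      ihα hc.of_mul_right_left, ihβ hc.of_mul_right_right]

theorem quarticSymbol_intCast_sq_eq {a : ℤ} {ω : GaussianInt} (ha : a % 2 = 1) (hω : 2 ∣ ω - 1)
    (h : IsCoprime (a : GaussianInt) ω) : quarticSymbol a ω ^ 2 = quarticSymbol ω a ^ 2 := by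
  rcases (show a % 4 = 1 ∨ a % 4 = 3 by omega) with h4 | h4
  · rw [quarticSymbol_intCast_eq h4 hω h]
  · have := quarticSymbol_intCast_eq (a := -a) (by omega) hω (by push_cast; exact h.neg_left)
    push_cast at this
    rw [← quarticSymbol_neg_left_sq hω, this, quarticSymbol_neg_right _ (isCoprime_intCast_two ha)]

/-- The imaginary unit as a unit of `ℤ[i]`. -/
def imagUnits : (GaussianInt)ˣ where
  val := imagUnit
  inv := -imagUnit
  val_inv := rfl
  inv_val := rfl

theorem imagUnits_pow_four : imagUnits ^ 4 = 1 := Units.ext imagUnit_pow_four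

theorem imagUnits_zpow_four_mul (n : ℤ) : imagUnits ^ (4 * n) = 1 := by
  rw [zpow_mul]
  have : imagUnits ^ (4 : ℤ) = 1 := by exact_mod_cast imagUnits_pow_four
  rw [this, one_zpow]

theorem imagUnits_zpow_eq_of_emod_eq {m n : ℤ} (h : m % 4 = n % 4) :
    imagUnits ^ m = imagUnits ^ n := by
  rw [← Int.mul_ediv_add_emod m 4, ← Int.mul_ediv_add_emod n 4, zpow_add, zpow_add,
    imagUnits_zpow_four_mul, imagUnits_zpow_four_mul, h]

theorem quarticSymbol_imagUnit_eq_zpow {ω : GaussianInt} (h : 2 ∣ ω - 1) :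
    quarticSymbol imagUnit ω = (imagUnits ^ (ω.norm / 4) : (GaussianInt)ˣ) := by
  rw [quarticSymbol_imagUnit h]
  have : ω.norm / 4 = ((ω.norm.natAbs / 4 : ℕ) : ℤ) := by
    have := GaussianInt.norm_nonneg ω
    omega
  rw [this, zpow_natCast, Units.val_pow_eq_pow_val]
  rfl

theorem intCast_two_dvd_sub_one {a : ℤ} (h : a % 2 = 1) : 2 ∣ (a : GaussianInt) - 1 :=
  two_dvd_sub_one_iff.2 (by simp; omega)

theorem quarticSymbol_imagUnit_intCast {a : ℤ} (h : a % 2 = 1) :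
    quarticSymbol imagUnit a = (imagUnits ^ ((a ^ 2 - 1) / 4) : (GaussianInt)ˣ) := by
  rw [quarticSymbol_imagUnit_eq_zpow (intCast_two_dvd_sub_one h), Zsqrtd.norm_intCast, ← sq]
  obtain ⟨b, rfl⟩ : ∃ b, a = 2 * b + 1 := ⟨a / 2, by omega⟩
  congr 2
  ring_nf
  omega

theorem sq_sub_one_div_four_emod_two {a : ℤ} (h : a % 2 = 1) : (a ^ 2 - 1) / 4 % 2 = 0 := by
  obtain ⟨b, rfl⟩ : ∃ b, a = 2 * b + 1 := ⟨a / 2, by omega⟩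
  obtain ⟨c, hc⟩ := (Int.even_mul_succ_self b).two_dvd
  rw [show (2 * b + 1) ^ 2 - 1 = 4 * (b * (b + 1)) by ring, hc]
  omega

theorem quarticSymbol_imagUnit_intCast_sq {a : ℤ} (h : a % 2 = 1) :
    quarticSymbol imagUnit (a : GaussianInt) ^ 2 = 1 := by
  rw [quarticSymbol_imagUnit_intCast h, ← Units.val_pow_eq_pow_val, ← zpow_natCast, ← zpow_mul,
    Units.val_eq_one, ← zpow_zero imagUnits]
  apply imagUnits_zpow_eq_of_emod_eq
  have := sq_sub_one_div_four_emod_two h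
  push_cast
  omega

/-- The supplementary law for `2`, modulo a Gaussian integer with coprime coordinates. -/
theorem quarticSymbol_two {ω : GaussianInt} (hω : 2 ∣ ω - 1) (hc : IsCoprime ω.re ω.im) :
    quarticSymbol 2 ω = (imagUnits ^ (ω.re * ω.im / 2) : (GaussianInt)ˣ) := by
  have hω2 := isCoprime_two_of_dvd_sub_one hω
  obtain ⟨hc1, hd0⟩ := two_dvd_sub_one_iff.1 hω
  obtain ⟨c, d, rfl⟩ : ∃ c d : ℤ, ω = c + d * imagUnit := ⟨_, _, eq_re_add_im_mul_imagUnit ω⟩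
  have hre : ((c : GaussianInt) + d * imagUnit).re = c := by simp [imagUnit]
  have him : ((c : GaussianInt) + d * imagUnit).im = d := by simp [imagUnit]
  rw [hre, him] at hc ⊢
  rw [hre] at hc1
  rw [him] at hd0
  set ω : GaussianInt := c + d * imagUnit with hωdef
  have hiu : IsUnit imagUnit := imagUnits.isUnit
  have hcd : IsCoprime (c : GaussianInt) ω := by
    have := (isCoprime_mul_unit_right_right hiu _ _).2 (isCoprime_intCast hc)
    have := this.add_mul_left_right 1
    rwa [mul_one, add_comm] at this
  have hs : IsCoprime ((c + d : ℤ) : GaussianInt) ω := by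
    have h1 : IsCoprime ((c + d : ℤ) : GaussianInt) (d * (1 - imagUnit)) := by
      refine (isCoprime_intCast (by simpa using hc.add_mul_right_left 1)).mul_right ?_
      refine (isCoprime_intCast_two (by omega)).of_isCoprime_of_dvd_right
        ⟨1 + imagUnit, by linear_combination imagUnit_sq⟩
    have := h1.neg_right.add_mul_left_right 1
    rwa [show -((d : GaussianInt) * (1 - imagUnit)) + ((c + d : ℤ) : GaussianInt) * 1 = ω by
      rw [hωdef]; push_cast; ring] at this
  have hsodd : (c + d) % 2 = 1 := by omega
  -- By reciprocity and ω ≡ di (mod c), the square is (i/c)² = 1.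
  have h1 : quarticSymbol c ω ^ 2 = 1 := by
    rw [quarticSymbol_intCast_sq_eq hc1 hω hcd,
      quarticSymbol_congr (isCoprime_intCast_two hc1) (β := d * imagUnit) ⟨1, by rw [hωdef]; ring⟩,
      quarticSymbol_mul_left _ _ (isCoprime_intCast_two hc1), mul_pow,
      quarticSymbol_intCast_intCast hc1 hc.symm, quarticSymbol_imagUnit_intCast_sq hc1]
    norm_num
  -- The square of the symbol of c + d is computed in two ways. By reciprocity it is (ω²/(c+d)), and
  -- ω² ≡ -2d²i (mod c+d).
  have h3 : quarticSymbol ((c + d : ℤ) : GaussianInt) ω ^ 2 =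
      quarticSymbol imagUnit ((c + d : ℤ) : GaussianInt) := by
    have hc3 : IsCoprime (-2 * d ^ 2) (c + d) := by
      have h5 : IsCoprime (c + d) (-2) := ⟨1, (c + d) / 2, by omega⟩
      have h6 : IsCoprime (c + d) d := by simpa using hc.add_mul_right_left 1
      exact (h5.mul_right h6.pow_right).symm
    rw [quarticSymbol_intCast_sq_eq hsodd hω hs,
      ← quarticSymbol_pow_left _ _ (isCoprime_intCast_two hsodd),
      quarticSymbol_congr (isCoprime_intCast_two hsodd) (β := ((-2 * d ^ 2 : ℤ) : GaussianInt) * imagUnit)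
        ⟨c - d + 2 * d * imagUnit, ?_⟩, quarticSymbol_mul_left _ _ (isCoprime_intCast_two hsodd),
      quarticSymbol_intCast_intCast hsodd hc3, one_mul]
    rw [hωdef]
    push_cast
    linear_combination (d : GaussianInt) ^ 2 * imagUnit_sq
  -- Directly modulo ω, d ≡ ci, so (c+d)² ≡ c²(1+i)² = 2ic².
  have h4 : quarticSymbol ((c + d : ℤ) : GaussianInt) ω ^ 2 =
      quarticSymbol 2 ω * quarticSymbol imagUnit ω := by
    rw [← quarticSymbol_pow_left _ _ hω2, quarticSymbol_congr hω2 (β := c ^ 2 * (2 * imagUnit))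
      ⟨c - d * imagUnit - 2 * c * imagUnit, ?_⟩, quarticSymbol_mul_left _ _ hω2,
      quarticSymbol_pow_left _ _ hω2, h1, one_mul, quarticSymbol_mul_left _ _ hω2]
    rw [hωdef]
    push_cast
    linear_combination ((d : GaussianInt) ^ 2 + 2 * c * d) * imagUnit_sq
  rw [h3, quarticSymbol_imagUnit_intCast hsodd, quarticSymbol_imagUnit_eq_zpow hω] at h4
  apply mul_right_cancel₀ (Units.ne_zero (imagUnits ^ ((ω.norm) / 4)))
  rw [← h4, ← Units.val_mul, ← zpow_add, norm_eq, hre, him]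
  congr 2
  obtain ⟨a, rfl⟩ : ∃ a, c = 2 * a + 1 := ⟨c / 2, by omega⟩
  obtain ⟨b, rfl⟩ : ∃ b, d = 2 * b := ⟨d / 2, by omega⟩
  rw [show (2 * a + 1 + 2 * b) ^ 2 - 1 = 4 * ((a + b) ^ 2 + (a + b)) by ring,
    show (2 * a + 1) ^ 2 + (2 * b) ^ 2 = 1 + 4 * (a ^ 2 + a + b ^ 2) by ring,
    show (2 * a + 1) * (2 * b) = 2 * ((2 * a + 1) * b) by ring,
    Int.mul_ediv_cancel_left _ (by norm_num), Int.mul_ediv_cancel_left _ (by norm_num),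
    Int.add_mul_ediv_left _ _ (by norm_num)]
  norm_num
  ring

/-- Quartic reciprocity for an arbitrary odd rational integer. -/
theorem quarticSymbol_intCast_eq_zpow_mul {a : ℤ} {ω : GaussianInt} (ha : a % 2 = 1)
    (hω : 2 ∣ ω - 1) (h : IsCoprime (a : GaussianInt) ω) :
    quarticSymbol a ω =
      (imagUnits ^ ((a - 1) * (ω.norm / 4)) : (GaussianInt)ˣ) * quarticSymbol ω a := by
  rcases (show a % 4 = 1 ∨ a % 4 = 3 by omega) with h4 | h4
  · obtain ⟨b, hb⟩ : ∃ b, a - 1 = 4 * b := ⟨a / 4, by omega⟩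
    rw [quarticSymbol_intCast_eq h4 hω h, hb, mul_assoc, imagUnits_zpow_four_mul, Units.val_one,
      one_mul]
  · have h1 := quarticSymbol_intCast_eq (a := -a) (by omega) hω (by push_cast; exact h.neg_left)
    push_cast at h1
    rw [quarticSymbol_neg_right _ (isCoprime_intCast_two ha)] at h1
    have h2 : quarticSymbol a ω = quarticSymbol (-1) ω * quarticSymbol (-a) ω := by
      rw [← quarticSymbol_mul_left _ _ (isCoprime_two_of_dvd_sub_one hω), neg_one_mul, neg_neg]
    have h3 : quarticSymbol (-1) ω =
        (imagUnits ^ ((a - 1) * (ω.norm / 4)) : (GaussianInt)ˣ) := by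
      rw [← imagUnit_sq, quarticSymbol_pow_left _ _ (isCoprime_two_of_dvd_sub_one hω),
        quarticSymbol_imagUnit_eq_zpow hω, ← Units.val_pow_eq_pow_val, ← zpow_natCast, ← zpow_mul]
      obtain ⟨b, hb⟩ : ∃ b, a - 1 = 4 * b + 2 := ⟨a / 4, by omega⟩
      congr 1
      apply imagUnits_zpow_eq_of_emod_eq
      rw [hb, show (4 * b + 2) * (ω.norm / 4) = 2 * (ω.norm / 4) + 4 * (b * (ω.norm / 4)) by ring]
      push_cast
      omega
    rw [h2, h1, h3]

/-! ### The symbols attached to ω = x + 2π -/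

/-- Take quartic symbols modulo ω in -qy² ≡ 2xA, which comes from ωω̄ = 2xA + qy² with A = x + 2C,
and invert each one by reciprocity. The coprimality of D and A makes ω coprime to all the rational
integers involved. -/
theorem quarticSymbol_add_two_mul_mul_quarticSymbol {p q C D x y : ℤ} (hp : p = C ^ 2 + D ^ 2)
    (hpodd : p % 2 = 1) (hxy : 4 * p = x ^ 2 + q * y ^ 2) (hq : q % 8 = 3) (hx : x % 2 = 1)
    (hy : y % 4 = 1) (hxp : IsCoprime x p) (hxq : IsCoprime x q) (hxy' : IsCoprime x y)
    (hD : IsCoprime D (x + 2 * C)) :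
    quarticSymbol ((x : GaussianInt) + 2 * (C + D * imagUnit)) q *
      quarticSymbol (C + D * imagUnit) y =
    (imagUnits ^ ((x + 2 * C) * D + ((x + 2 * C) ^ 2 - 1) / 4) : (GaussianInt)ˣ) *
      quarticSymbol (C + D * imagUnit) x := by
  set A := x + 2 * C with hA
  set π : GaussianInt := C + D * imagUnit with hπ
  set ω : GaussianInt := x + 2 * π with hω
  have hωA : ω = (A : GaussianInt) + (2 * D : ℤ) * imagUnit := by
    rw [hω, hA, hπ]; push_cast; ring
  have hre : ω.re = A := by rw [hωA]; simp [imagUnit]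
  have him : ω.im = 2 * D := by rw [hωA]; simp [imagUnit]
  have hAodd : A % 2 = 1 := by omega
  have hω1 : 2 ∣ ω - 1 := by rw [two_dvd_sub_one_iff, hre, him]; omega
  have hω2 := isCoprime_two_of_dvd_sub_one hω1
  have hAD : IsCoprime A (2 * D) := by
    have h2 : IsCoprime A 2 := ⟨1, -(A / 2), by omega⟩
    exact h2.mul_right hD.symm
  have hAqy : IsCoprime A (q * y ^ 2) := by
    have h : IsCoprime A ((2 * D) ^ 2) := hAD.pow_right
    have h1 := h.add_mul_left_right (-(x - 2 * C))
    rwa [show (2 * D) ^ 2 + A * -(x - 2 * C) = q * y ^ 2 by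
      rw [hA]; linear_combination hxy - 4 * hp] at h1
  have hAq : IsCoprime A q := hAqy.of_mul_right_left
  have hAy : IsCoprime A y := (hAqy.of_mul_right_right).of_isCoprime_of_dvd_right
    (dvd_pow_self y two_ne_zero)
  have hπp : (p : GaussianInt) = π * star π := by
    rw [hp, hπ, star_add, star_mul, star_imagUnit, star_intCast, star_intCast]
    push_cast
    linear_combination (D : GaussianInt) ^ 2 * imagUnit_sq
  have hω' : ω * star ω = 2 * x * A + q * y ^ 2 := by
    have h1 : ω.norm = 2 * x * A + q * y ^ 2 := by
      rw [norm_eq, hre, him, hA]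
      linear_combination hxy - 4 * hp
    rw [← Zsqrtd.norm_eq_mul_conj, h1]
    push_cast; ring
  have hqodd : q % 2 = 1 := by omega
  have hyodd : y % 2 = 1 := by omega
  have coprime_two {a : ℤ} (ha : a % 2 = 1) : IsCoprime a 2 := ⟨1, -(a / 2), by omega⟩
  have hxπ : IsCoprime (x : GaussianInt) π := by
    have := isCoprime_intCast hxp
    rw [hπp] at this
    exact this.of_mul_right_left
  have hcoprime {r s : ℤ} (h1 : IsCoprime r (2 * x * A)) (h2 : q * y ^ 2 = r * s) :
      IsCoprime (r : GaussianInt) ω := by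
    have h3 := (isCoprime_intCast h1).add_mul_left_right (s : GaussianInt)
    have h4 : ((2 * x * A : ℤ) : GaussianInt) + r * s = ω * star ω := by
      rw [hω', ← Int.cast_mul, ← h2]; push_cast; ring
    rw [h4] at h3
    exact h3.of_mul_right_left
  have hqω : IsCoprime (q : GaussianInt) ω :=
    hcoprime (((coprime_two hqodd).mul_right hxq.symm).mul_right hAq.symm) rfl
  have hyω : IsCoprime (y : GaussianInt) ω :=
    hcoprime (s := q * y) (((coprime_two hyodd).mul_right hxy'.symm).mul_right hAy.symm) (by ring)
  have hxω : IsCoprime (x : GaussianInt) ω := by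
    have := ((isCoprime_intCast_two hx).mul_right hxπ).add_mul_left_right 1
    rwa [mul_one, add_comm] at this
  have hAω : IsCoprime (A : GaussianInt) ω := by
    have := ((isCoprime_mul_unit_right_right imagUnits.isUnit _ _).2
      (isCoprime_intCast hAD)).add_mul_left_right 1
    rwa [mul_one, add_comm, show (imagUnits : GaussianInt) = imagUnit from rfl, ← hωA] at this
  -- -q ≡ 1 (mod 4), so reciprocity carries no sign.
  have e1 : quarticSymbol (-q : ℤ) ω = quarticSymbol ω q := by
    rw [quarticSymbol_intCast_eq (by omega) hω1 (by push_cast; exact hqω.neg_left)]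
    push_cast
    exact quarticSymbol_neg_right _ (isCoprime_intCast_two hqodd)
  -- Modulo y, x² ≡ 4ππ̄, so ω² ≡ 4π(π̄ + x + π) = 4Aπ; the rational factor 4A has symbol 1.
  have e2 : quarticSymbol y ω ^ 2 = quarticSymbol π y := by
    have hy2 := isCoprime_intCast_two hyodd
    rw [quarticSymbol_intCast_eq hy hω1 hyω, ← quarticSymbol_pow_left _ _ hy2,
      quarticSymbol_congr hy2 (β := ((2 * 2 * A : ℤ) : GaussianInt) * π) ⟨-q * y, ?_⟩,
      quarticSymbol_mul_left _ _ hy2, quarticSymbol_intCast_intCast hyodd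
      (((coprime_two hyodd).symm.mul_left (coprime_two hyodd).symm).mul_left hAy), one_mul]
    have h1 := congrArg (Int.cast (R := GaussianInt)) hxy
    have h2 : π * star π = π * (2 * C - π) := by
      rw [hπ, star_add, star_mul, star_imagUnit, star_intCast, star_intCast]; ring
    push_cast at h1
    rw [hω, hA]
    push_cast
    linear_combination -h1 + 4 * hπp + 4 * h2
  have e3 : quarticSymbol (-q : ℤ) ω * quarticSymbol y ω ^ 2 =
      quarticSymbol 2 ω * quarticSymbol x ω * quarticSymbol A ω := by
    rw [← quarticSymbol_pow_left _ _ hω2, ← quarticSymbol_mul_left _ _ hω2,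
      ← quarticSymbol_mul_left _ _ hω2, ← quarticSymbol_mul_left _ _ hω2]
    refine quarticSymbol_congr hω2 ⟨-star ω, ?_⟩
    push_cast
    linear_combination hω'
  have e4 : quarticSymbol 2 ω = (imagUnits ^ (A * D) : (GaussianInt)ˣ) := by
    rw [quarticSymbol_two hω1 (by rw [hre, him]; exact hAD), hre, him,
      show A * (2 * D) = 2 * (A * D) by ring, Int.mul_ediv_cancel_left _ (by norm_num)]
  have e5 : quarticSymbol ω x = quarticSymbol π x := by
    have hx2 := isCoprime_intCast_two hx
    rw [quarticSymbol_congr hx2 (β := ((2 : ℤ) : GaussianInt) * π)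
      ⟨1, by rw [hω]; push_cast; ring⟩, quarticSymbol_mul_left _ _ hx2,
      quarticSymbol_intCast_intCast hx (coprime_two hx).symm, one_mul]
  have e6 : quarticSymbol ω A = (imagUnits ^ ((A ^ 2 - 1) / 4) : (GaussianInt)ˣ) := by
    have hA2 := isCoprime_intCast_two hAodd
    rw [quarticSymbol_congr hA2 (β := ((2 * D : ℤ) : GaussianInt) * imagUnit)
      ⟨1, by rw [hωA]; ring⟩, quarticSymbol_mul_left _ _ hA2,
      quarticSymbol_intCast_intCast hAodd hAD.symm, one_mul, quarticSymbol_imagUnit_intCast hAodd]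
  rw [← e1, ← e2, e3, e4, quarticSymbol_intCast_eq_zpow_mul hx hω1 hxω,
    quarticSymbol_intCast_eq_zpow_mul hAodd hω1 hAω, e5, e6]
  -- The signs from inverting (x/ω) and (A/ω) cancel: (x-1) + (A-1) = 2(x-1) + 2C, and CD is even
  -- because p is odd.
  have e7 : (imagUnits ^ ((x - 1) * (ω.norm / 4)) * imagUnits ^ ((A - 1) * (ω.norm / 4)) :
      (GaussianInt)ˣ) = 1 := by
    rw [← zpow_add, ← zpow_zero imagUnits]
    apply imagUnits_zpow_eq_of_emod_eq
    rw [norm_eq, hre, him, ← add_mul]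
    obtain ⟨a, ha⟩ : ∃ a, x = 2 * a + 1 := ⟨x / 2, by omega⟩
    obtain ⟨b, hb⟩ : ∃ b, A = 2 * b + 1 := ⟨A / 2, by omega⟩
    have hCD : ∃ t, C * D = 2 * t := by
      rcases Int.even_or_odd' C with ⟨s, hs | hs⟩
      · exact ⟨s * D, by rw [hs]; ring⟩
      rcases Int.even_or_odd' D with ⟨t, ht | ht⟩
      · exact ⟨C * t, by rw [ht]; ring⟩
      · exfalso
        rw [hp, hs, ht] at hpodd
        ring_nf at hpodd
        omega
    obtain ⟨t, ht⟩ := hCD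
    obtain ⟨s, hs⟩ : ∃ s, b * (b + 1) = 2 * s := (Int.even_mul_succ_self b).two_dvd
    have hN : (A ^ 2 + (2 * D) ^ 2) / 4 = 2 * s + D ^ 2 := by
      rw [hb, show (2 * b + 1) ^ 2 + (2 * D) ^ 2 = 1 + 4 * (b * (b + 1) + D ^ 2) by ring, hs,
        Int.add_mul_ediv_left _ _ (by norm_num)]
      norm_num
    rw [hN, show (x - 1 + (A - 1)) * (2 * s + D ^ 2) =
      4 * (t * D + a * D ^ 2 * 2 + (a * 2 + C) * s - a * D ^ 2) by
        rw [hA, ha]; linear_combination 2 * D * ht]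
    simp
  rw [zpow_add, Units.val_mul]
  have e8 := congrArg Units.val e7
  rw [Units.val_mul, Units.val_one] at e8
  linear_combination ((imagUnits ^ (A * D) : (GaussianInt)ˣ) : GaussianInt) * quarticSymbol π x *
    ((imagUnits ^ ((A ^ 2 - 1) / 4) : (GaussianInt)ˣ) : GaussianInt) * e8

/-- The quartic symbol of `x + 2π` modulo a rational prime `q ≡ 3 (mod 4)` with `x² ≡ 4 N π`,
computed from the element `2 conj(π) / x` of norm one. -/
theorem quarticSymbol_add_two_mul_eq {q : ℕ} (hq : q.Prime) (hq4 : q % 4 = 3) {x : ℤ}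
    {π u : GaussianInt} (hx : ¬ (q : GaussianInt) ∣ x) (hω : ¬ (q : GaussianInt) ∣ x + 2 * π)
    (hN : (q : GaussianInt) ∣ x ^ 2 - 4 * (π * star π)) (hu : u ^ 4 = 1)
    (h : (q : GaussianInt) ∣ (2 * star π) ^ ((q + 1) / 4) - x ^ ((q + 1) / 4) * u) :
    quarticSymbol (x + 2 * π) q = u := by
  have hF := Fact.mk hq
  have hp := GaussianInt.prime_of_nat_prime_of_mod_four_eq_three q hq4
  have h2 := not_dvd_two_of_isCoprime hp (isCoprime_natCast_two (by omega))
  rw [quarticSymbol_of_prime hp h2]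
  refine primeQuarticSymbol_eq hp h2 hu ?_
  set ω : GaussianInt := x + 2 * π with hωdef
  set k := (q + 1) / 4 with hk
  have hnorm : (q : GaussianInt).norm.natAbs / 4 = (q - 1) * k := by
    rw [Zsqrtd.norm_natCast, Int.natAbs_mul, Int.natAbs_natCast, hk]
    obtain ⟨j, rfl⟩ : ∃ j, q = 4 * j + 3 := ⟨q / 4, by omega⟩
    rw [show 4 * j + 3 + 1 = 4 * (j + 1) by ring, Nat.mul_div_cancel_left _ (by norm_num),
      show (4 * j + 3) * (4 * j + 3) = 1 + 4 * ((4 * j + 2) * (j + 1)) by ring,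
      Nat.add_mul_div_left _ _ (by norm_num)]
    simp
  rw [hnorm]
  -- Frobenius gives ω^q ≡ ω̄, and xω̄ ≡ 2π̄ω because x² ≡ 4ππ̄. Thus ω^(q-1) ≡ 2π̄/x, and its
  -- (q+1)/4-th power is the symbol.
  have h1 : (q : GaussianInt) ∣ x * ω ^ q - 2 * star π * ω := by
    have h3 := dvd_add ((natPrime_dvd_pow_sub_star hq hq4 ω).mul_left (x : GaussianInt)) hN
    convert h3 using 1
    rw [hωdef, star_add, star_mul, star_intCast, star_ofNat]
    ring
  have h3 := h1.trans (sub_dvd_pow_sub_pow _ _ k)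
  have h4 := dvd_add h3 (h.mul_right (ω ^ k))
  have h5 : (q : GaussianInt) ∣ (x * ω) ^ k * (ω ^ ((q - 1) * k) - u) := by
    convert h4 using 1
    obtain ⟨r, rfl⟩ : ∃ r, q = r + 1 := ⟨q - 1, by omega⟩
    rw [Nat.add_sub_cancel, pow_succ ω r, mul_pow, mul_pow, mul_pow, mul_pow, pow_mul]
    ring
  rcases hp.dvd_or_dvd h5 with h6 | h6
  · rcases hp.dvd_or_dvd (hp.dvd_of_dvd_pow h6) with h7 | h7
    · exact absurd h7 hx
    · exact absurd h7 hω
  · exact h6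

open Complex in
-- Multiplying by x^k clears the remaining denominator, and t is cancelled because it is prime to q.
theorem dvd_of_gaussianCongr {q : ℕ} {x m : ℤ} {π : GaussianInt} {k : ℕ} (hx : x ≠ 0)
    (h : GaussianCongr q ((2 * toComplex (star π) / (x : ℂ)) ^ k) (Complex.I ^ m)) :
    (q : GaussianInt) ∣
      (2 * star π) ^ k - x ^ k * ((imagUnits ^ m : (GaussianInt)ˣ) : GaussianInt) := by
  obtain ⟨t, ht, γ, hγ⟩ := h
  have hI : toComplex ((imagUnits ^ m : (GaussianInt)ˣ) : GaussianInt) = Complex.I ^ m := by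
    have : Units.map (toComplex : GaussianInt →* ℂ) (imagUnits ^ m) =
        (Units.mk0 Complex.I I_ne_zero) ^ m := by
      rw [map_zpow]
      congr 1
      ext
      simp [imagUnits, imagUnit, toComplex_def]
    have h2 := congrArg Units.val this
    rw [Units.val_zpow_eq_zpow_val] at h2
    exact h2
  have hxC : (x : ℂ) ≠ 0 := by exact_mod_cast hx
  have key : (t : GaussianInt) * ((2 * star π) ^ k -
      x ^ k * ((imagUnits ^ m : (GaussianInt)ˣ) : GaussianInt)) = q * (γ * x ^ k) := by
    rw [← toComplex_inj]
    simp only [map_mul, map_sub, map_pow, map_intCast, map_natCast, map_ofNat, hI]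
    rw [div_pow] at hγ
    have h3 : (2 * toComplex (star π)) ^ k =
        (2 * toComplex (star π)) ^ k / (x : ℂ) ^ k * (x : ℂ) ^ k := by
      field_simp
    rw [h3]
    push_cast at hγ
    linear_combination (x : ℂ) ^ k * hγ
  have hc := isCoprime_intCast ht
  rw [Int.cast_natCast] at hc
  exact hc.symm.dvd_of_dvd_mul_left ⟨_, key⟩

/-! ### Reduction modulo p and coprimality conditions -/

/-- The ring homomorphism `ℤ[i] → ZMod p` with kernel generated by a prime of norm `p`. -/
theorem exists_ringHom_zmod {p : ℕ} [Fact p.Prime] {c d : ℤ} (hcd : (p : ℤ) = c ^ 2 + d ^ 2)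
    (hc : (c : ZMod p) ≠ 0) :
    ∃ θ : GaussianInt →+* ZMod p, θ imagUnit = (d : ZMod p) / c ∧ θ (c + d * imagUnit) = 0 := by
  have h : (c : ZMod p) ^ 2 + (d : ZMod p) ^ 2 = 0 := by
    have := congrArg (Int.cast (R := ZMod p)) hcd
    push_cast at this
    rw [← this, ZMod.natCast_self]
  have hsq : ((d : ZMod p) / c) * (d / c) = ((-1 : ℤ) : ZMod p) := by
    field_simp
    push_cast
    linear_combination h
  refine ⟨Zsqrtd.lift ⟨_, hsq⟩, by simp [imagUnit], ?_⟩
  simp [imagUnit]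
  field_simp
  linear_combination h

theorem map_imagUnits_zpow {p : ℕ} [Fact p.Prime] (θ : GaussianInt →+* ZMod p) (n : ℤ) :
    θ ((imagUnits ^ n : (GaussianInt)ˣ) : GaussianInt) = (θ imagUnit) ^ n := by
  have h := congrArg Units.val (map_zpow (Units.map (θ : GaussianInt →* ZMod p)) imagUnits n)
  rw [Units.val_zpow_eq_zpow_val] at h
  exact h

/-- Euler's criterion modulo `p`. -/
theorem map_quarticSymbol_intCast {p : ℕ} [Fact p.Prime] {π : GaussianInt} (hπ : Prime π)
    (h2 : ¬ π ∣ 2) (hN : π.norm = p) (θ : GaussianInt →+* ZMod p) (hθ : θ π = 0) {a : ℤ}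
    (ha : ¬ π ∣ (a : GaussianInt)) : θ (quarticSymbol a π) = (a : ZMod p) ^ (p / 4) := by
  obtain ⟨β, hβ⟩ := (primeQuarticSymbol_spec hπ h2 ha).2
  have h := congrArg θ hβ
  rw [hN, Int.natAbs_natCast, map_mul, hθ, zero_mul, map_sub, sub_eq_zero, map_pow,
    map_intCast] at h
  rw [quarticSymbol_of_prime hπ h2, h]

/-- If p ∣ x then p ∣ y, so p² ∣ 4p, which is impossible. If q ∣ x then q ∣ 4p. A common prime of x
and y divides 4p and is odd, so it is p, already excluded. -/
theorem isCoprime_of_four_mul_eq {p q : ℕ} (hp : p.Prime) (hq : q.Prime) (hpq : p ≠ q)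
    (hp2 : p ≠ 2) (hq2 : q ≠ 2) {x y : ℤ} (hxy : 4 * (p : ℤ) = x ^ 2 + (q : ℤ) * y ^ 2)
    (hy : y % 2 = 1) : IsCoprime x p ∧ IsCoprime x q ∧ IsCoprime x y := by
  have hpZ := Nat.prime_iff_prime_int.1 hp
  have hqZ := Nat.prime_iff_prime_int.1 hq
  have hp4 : ¬ (p : ℤ) ∣ 4 := fun h => by
    have h1 : p ∣ 2 ^ 2 := by exact_mod_cast h
    exact hp2 ((Nat.prime_dvd_prime_iff_eq hp Nat.prime_two).1 (hp.dvd_of_dvd_pow h1))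
  have hq4 : ¬ (q : ℤ) ∣ 4 := fun h => by
    have h1 : q ∣ 2 ^ 2 := by exact_mod_cast h
    exact hq2 ((Nat.prime_dvd_prime_iff_eq hq Nat.prime_two).1 (hq.dvd_of_dvd_pow h1))
  have hpq' : ¬ (p : ℤ) ∣ q := by
    rwa [Int.natCast_dvd_natCast, Nat.prime_dvd_prime_iff_eq hp hq]
  have hqp' : ¬ (q : ℤ) ∣ p := by
    rw [Int.natCast_dvd_natCast, Nat.prime_dvd_prime_iff_eq hq hp]
    exact hpq.symm
  have hpx : ¬ (p : ℤ) ∣ x := by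
    intro h
    have h1 : (p : ℤ) ∣ q * y ^ 2 := by
      have : (q : ℤ) * y ^ 2 = p * 4 - x * x := by linear_combination -hxy
      rw [this]
      exact dvd_sub (dvd_mul_right _ _) (h.mul_right x)
    have h2 := hpZ.dvd_of_dvd_pow ((hpZ.dvd_or_dvd h1).resolve_left hpq')
    obtain ⟨a, rfl⟩ := h
    obtain ⟨b, rfl⟩ := h2
    refine hp4 ⟨a ^ 2 + q * b ^ 2, mul_left_cancel₀ hpZ.ne_zero ?_⟩
    linear_combination hxy
  refine ⟨((hpZ.irreducible.coprime_iff_not_dvd).2 hpx).symm,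
    ((hqZ.irreducible.coprime_iff_not_dvd).2 fun h => ?_).symm, ?_⟩
  · have h1 : (q : ℤ) ∣ 4 * p := by
      rw [hxy, sq]
      exact dvd_add (h.mul_right x) (dvd_mul_right _ _)
    exact (hqZ.dvd_or_dvd h1).elim hq4 hqp'
  · refine isCoprime_of_prime_dvd (fun h => by omega) fun z hz hzx hzy => ?_
    have h1 : z ∣ 2 * 2 * p := by
      rw [show (2 : ℤ) * 2 * p = x * x + q * y * y by linear_combination hxy]
      exact dvd_add (hzx.mul_right x) (hzy.mul_left _)
    have h2 : ¬ z ∣ 2 := fun h => hz.not_isUnit (by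
      have h3 : IsCoprime (2 : ℤ) y := ⟨-(y / 2), 1, by omega⟩
      exact h3.isUnit_of_dvd' h hzy)
    rcases hz.dvd_or_dvd h1 with h3 | h3
    · exact (hz.dvd_or_dvd h3).elim h2 h2
    · exact hpx (((hz.dvd_prime_iff_associated hpZ).1 h3).symm.dvd.trans hzx)

theorem not_dvd_add_two_mul {q : ℕ} (hq : q.Prime) (hq2 : q ≠ 2) {C D x : ℤ}
    (h : IsCoprime D (x + 2 * C)) :
    ¬ (q : GaussianInt) ∣ x + 2 * (C + D * imagUnit) := by
  intro hd
  rw [← Int.cast_natCast, Zsqrtd.intCast_dvd] at hd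
  simp [imagUnit] at hd
  have hqZ := Nat.prime_iff_prime_int.1 hq
  have h2 : ¬ (q : ℤ) ∣ 2 := fun h => hq2 <| by
    rwa [← Nat.cast_ofNat, Int.natCast_dvd_natCast, Nat.prime_dvd_prime_iff_eq hq Nat.prime_two] at h
  exact hqZ.not_isUnit (h.isUnit_of_dvd' ((hqZ.dvd_or_dvd hd.2).resolve_left h2) hd.1)

/-- Stated for a general representation p = C² + D², so that it serves both (c, d) and the rotated
pair (d, -c). -/
theorem zpow_mul_quarticSymbol_eq {p q : ℕ} (hp : p.Prime) (hq : q.Prime) (hp4 : p % 4 = 1)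
    (hq8 : q % 8 = 3) {C D x y n : ℤ} (hCD : (p : ℤ) = C ^ 2 + D ^ 2)
    (hxy : 4 * (p : ℤ) = x ^ 2 + (q : ℤ) * y ^ 2) (hx : x % 2 = 1) (hy : y % 4 = 1)
    (hD : IsCoprime D (x + 2 * C))
    (h : (q : GaussianInt) ∣ (2 * star ((C : GaussianInt) + D * imagUnit)) ^ ((q + 1) / 4) -
      x ^ ((q + 1) / 4) * ((imagUnits ^ n : (GaussianInt)ˣ) : GaussianInt)) :
    ((imagUnits ^ n : (GaussianInt)ˣ) : GaussianInt) * quarticSymbol (C + D * imagUnit) y =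
    (imagUnits ^ ((x + 2 * C) * D + ((x + 2 * C) ^ 2 - 1) / 4) : (GaussianInt)ˣ) *
      quarticSymbol (C + D * imagUnit) x := by
  obtain ⟨h1, h2, h3⟩ := isCoprime_of_four_mul_eq hp hq (by rintro rfl; omega)
    (by rintro rfl; omega) (by rintro rfl; omega) hxy (by omega)
  have hqZ := Nat.prime_iff_prime_int.1 hq
  rw [← quarticSymbol_add_two_mul_mul_quarticSymbol hCD (by omega) hxy (by omega) hx hy h1 h2 h3 hD,
    Int.cast_natCast, quarticSymbol_add_two_mul_eq hq (by omega) ?_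
      (not_dvd_add_two_mul hq (by rintro rfl; omega) hD) ?_ ?_ h]
  · rw [← Int.cast_natCast, Zsqrtd.intCast_dvd_intCast]
    exact fun hd => hqZ.not_isUnit (h2.isUnit_of_dvd' hd dvd_rfl)
  · have h4 := congrArg (Int.cast (R := GaussianInt)) hxy
    have h5 := congrArg (Int.cast (R := GaussianInt)) hCD
    push_cast at h4 h5
    refine ⟨-y ^ 2, ?_⟩
    rw [star_add, star_mul, star_imagUnit, star_intCast, star_intCast]
    linear_combination -h4 + 4 * h5 + 4 * (D : GaussianInt) ^ 2 * imagUnit_sq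
  · rw [← Units.val_pow_eq_pow_val, Units.val_eq_one, ← zpow_natCast, ← zpow_mul, mul_comm]
    exact imagUnits_zpow_four_mul n

/-! ### Exponents of i modulo 4 -/

theorem sq_sub_one_div_four (b : ℤ) : ((2 * b + 1) ^ 2 - 1) / 4 = b * (b + 1) := by
  rw [show (2 * b + 1) ^ 2 - 1 = 4 * (b * (b + 1)) by ring,
    Int.mul_ediv_cancel_left _ (by norm_num)]

theorem neg_one_pow_exponent_of_emod_eight_eq_one {x e : ℤ} (hx : x % 2 = 1)
    (he : e = x / 4 + 1) : 2 * e % 4 = (1 + x + (x ^ 2 - 1) / 4) % 4 := by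
  obtain ⟨t, ht⟩ : ∃ t, x = 8 * t + 1 ∨ x = 8 * t + 3 ∨ x = 8 * t + 5 ∨ x = 8 * t + 7 :=
    ⟨x / 8, by omega⟩
  rcases ht with h | h | h | h
  · have := sq_sub_one_div_four (4 * t)
    rw [h, he, h, show 8 * t + 1 = 2 * (4 * t) + 1 by ring, this]
    ring_nf
    omega
  · have := sq_sub_one_div_four (4 * t + 1)
    rw [h, he, h, show 8 * t + 3 = 2 * (4 * t + 1) + 1 by ring, this]
    ring_nf
    omega
  · have := sq_sub_one_div_four (4 * t + 2)
    rw [h, he, h, show 8 * t + 5 = 2 * (4 * t + 2) + 1 by ring, this]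
    ring_nf
    omega
  · have := sq_sub_one_div_four (4 * t + 3)
    rw [h, he, h, show 8 * t + 7 = 2 * (4 * t + 3) + 1 by ring, this]
    ring_nf
    omega

theorem neg_one_pow_exponent_of_emod_eight_eq_five {x e : ℤ} (hx : x % 2 = 1)
    (he : e = (x ^ 2 - 1) / 8) : 2 * e % 4 = ((x ^ 2 - 1) / 4) % 4 := by
  have := sq_sub_one_div_four_emod_two hx
  omega

theorem exists_sum_two_squares_parametrization {p c d : ℤ} (hcd : p = c ^ 2 + d ^ 2)
    (hp : p % 4 = 1) (hc : c % 4 = 1) : ∃ a b, c = 4 * a + 1 ∧ d = 2 * b ∧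
      p / 4 = 4 * a ^ 2 + 2 * a + b ^ 2 ∧ (p % 8 = 1 → b % 2 = 0) ∧ (p % 8 = 5 → b % 2 = 1) := by
  have hd : d % 2 = 0 := by
    rcases Int.even_or_odd' d with ⟨b, hb | hb⟩
    · omega
    · obtain ⟨a, rfl⟩ : ∃ a, c = 4 * a + 1 := ⟨c / 4, by omega⟩
      rw [hcd, hb] at hp
      ring_nf at hp
      omega
  obtain ⟨a, ha⟩ : ∃ a, c = 4 * a + 1 := ⟨c / 4, by omega⟩
  obtain ⟨b, hb⟩ : ∃ b, d = 2 * b := ⟨d / 2, by omega⟩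
  have h4 : p = 4 * (4 * a ^ 2 + 2 * a + b ^ 2) + 1 := by rw [hcd, ha, hb]; ring
  refine ⟨a, b, ha, hb, by omega, fun h => ?_, fun h => ?_⟩ <;>
    rcases Int.even_or_odd' b with ⟨e, he | he⟩
  · omega
  · rw [h4, he] at h; ring_nf at h; omega
  · rw [h4, he] at h; ring_nf at h; omega
  · omega

/-- The left side is the exponent from the comparison with (C, D) = (c, d), less the reciprocity
exponent for x. Writing d = 2b, the parity of b is decided by p modulo 8. -/
theorem exponent_emod_four_of_coprime_right {p c d x m e : ℤ} (hcd : p = c ^ 2 + d ^ 2)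
    (hx : x % 2 = 1) (hc : c % 4 = 1)
    (he : (p % 8 = 1 ∧ e = x / 4 + 1) ∨ (p % 8 = 5 ∧ e = (x ^ 2 - 1) / 8)) :
    (m - ((x + 2 * c) * d + ((x + 2 * c) ^ 2 - 1) / 4) - (x - 1) * (p / 4)) % 4 =
      (m + 2 * e) % 4 := by
  obtain ⟨a, b, ha, hb, hp, hb1, hb5⟩ := exists_sum_two_squares_parametrization hcd
    (by omega) hc
  obtain ⟨s, hs⟩ : ∃ s, x = 2 * s + 1 := ⟨x / 2, by omega⟩
  rcases he with ⟨h8, he⟩ | ⟨h8, he⟩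
  · obtain ⟨f, hf⟩ : ∃ f, b = 2 * f := ⟨b / 2, by have := hb1 h8; omega⟩
    have h2e := neg_one_pow_exponent_of_emod_eight_eq_one hx he
    rw [hs, sq_sub_one_div_four] at h2e
    rw [hp, hb, hf, ha, hs, show 2 * s + 1 + 2 * (4 * a + 1) = 2 * (s + 4 * a + 1) + 1 by ring,
      sq_sub_one_div_four]
    ring_nf at h2e ⊢
    omega
  · obtain ⟨f, hf⟩ : ∃ f, b = 2 * f + 1 := ⟨b / 2, by have := hb5 h8; omega⟩
    have h2e := neg_one_pow_exponent_of_emod_eight_eq_five hx he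
    rw [hs, sq_sub_one_div_four] at h2e
    rw [hp, hb, hf, ha, hs, show 2 * s + 1 + 2 * (4 * a + 1) = 2 * (s + 4 * a + 1) + 1 by ring,
      sq_sub_one_div_four]
    ring_nf at h2e ⊢
    omega

/-- For (C, D) = (d, -c) the rotation by -i adds (q+1)/4 and the exponents of (i/x) and (i/y). The
equation 4p = x² + qy² is now needed to relate them modulo 4. -/
theorem exponent_emod_four_of_coprime_left {p q c d x y m e : ℤ} (hcd : p = c ^ 2 + d ^ 2)
    (hxy : 4 * p = x ^ 2 + q * y ^ 2) (hx : x % 2 = 1) (hc : c % 4 = 1) (hy : y % 4 = 1)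
    (hq : q % 8 = 3)
    (he : (p % 8 = 1 ∧ e = x / 4 + 1) ∨ (p % 8 = 5 ∧ e = (x ^ 2 - 1) / 8)) :
    ((q + 1) / 4 + m + (y ^ 2 - 1) / 4 - ((x + 2 * d) * -c + ((x + 2 * d) ^ 2 - 1) / 4) -
      (x ^ 2 - 1) / 4 - (x - 1) * (p / 4)) % 4 = (m + 2 * e) % 4 := by
  obtain ⟨a, b, ha, hb, hp, hb1, hb5⟩ := exists_sum_two_squares_parametrization hcd
    (by omega) hc
  obtain ⟨s, hs⟩ : ∃ s, x = 2 * s + 1 := ⟨x / 2, by omega⟩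
  obtain ⟨t, ht⟩ : ∃ t, y = 2 * (2 * t) + 1 := ⟨y / 4, by omega⟩
  obtain ⟨r, hr⟩ : ∃ r, q = 8 * r + 3 := ⟨q / 8, by omega⟩
  have hk : (q + 1) / 4 = 2 * r + 1 := by omega
  -- Replacing s² by 2w - s records that s² + s is even and leaves the term in a form linear
  -- arithmetic can use.
  obtain ⟨w, hw⟩ : ∃ w, s * (s + 1) = 2 * w := (Int.even_mul_succ_self s).two_dvd
  have hw' : s ^ 2 = 2 * w - s := by linear_combination hw
  rw [hcd, hs, ht, hr, ha, hb] at hxy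
  rcases he with ⟨h8, he⟩ | ⟨h8, he⟩
  · obtain ⟨f, hf⟩ : ∃ f, b = 2 * f := ⟨b / 2, by have := hb1 h8; omega⟩
    have h2e := neg_one_pow_exponent_of_emod_eight_eq_one hx he
    rw [hs, sq_sub_one_div_four] at h2e
    rw [hf] at hxy
    rw [hk, hp, hb, hf, ha, hs, ht, show 2 * s + 1 + 2 * (2 * (2 * f)) = 2 * (s + 4 * f) + 1 by ring,
      sq_sub_one_div_four, sq_sub_one_div_four, sq_sub_one_div_four]
    ring_nf at h2e hxy ⊢
    rw [hw'] at h2e hxy ⊢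
    omega
  · obtain ⟨f, hf⟩ : ∃ f, b = 2 * f + 1 := ⟨b / 2, by have := hb5 h8; omega⟩
    have h2e := neg_one_pow_exponent_of_emod_eight_eq_five hx he
    rw [hs, sq_sub_one_div_four] at h2e
    rw [hf] at hxy
    rw [hk, hp, hb, hf, ha, hs, ht,
      show 2 * s + 1 + 2 * (2 * (2 * f + 1)) = 2 * (s + 4 * f + 2) + 1 by ring,
      sq_sub_one_div_four, sq_sub_one_div_four, sq_sub_one_div_four]
    ring_nf at h2e hxy ⊢
    rw [hw'] at h2e hxy ⊢
    omega

/-! ### Comparison of the symbols of x and y modulo c + di -/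

/-- The reciprocity factor has an even exponent, so it is ±1 and its own inverse. -/
theorem quarticSymbol_eq_zpow_mul_intCast {p : ℕ} {π : GaussianInt} {a : ℤ} (ha : a % 2 = 1)
    (hπ : 2 ∣ π - 1) (h : IsCoprime (a : GaussianInt) π) (hN : π.norm = p) :
    quarticSymbol π a =
      (imagUnits ^ ((a - 1) * ((p : ℤ) / 4)) : (GaussianInt)ˣ) * quarticSymbol a π := by
  rw [quarticSymbol_intCast_eq_zpow_mul ha hπ h, hN, ← mul_assoc, ← Units.val_mul, ← zpow_add]
  obtain ⟨b, hb⟩ : ∃ b, a - 1 = 2 * b := ⟨a / 2, by omega⟩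
  rw [show (a - 1) * ((p : ℤ) / 4) + (a - 1) * ((p : ℤ) / 4) = 4 * (b * ((p : ℤ) / 4)) by
    rw [hb]; ring, imagUnits_zpow_four_mul, Units.val_one, one_mul]

theorem zpow_mul_eq_iff {m n : ℤ} {α β : GaussianInt} :
    ((imagUnits ^ m : (GaussianInt)ˣ) : GaussianInt) * α = (imagUnits ^ n : (GaussianInt)ˣ) * β ↔
      β = (imagUnits ^ (m - n) : (GaussianInt)ˣ) * α := by
  rw [sub_eq_neg_add, zpow_add, zpow_neg, Units.val_mul, mul_assoc, Units.eq_inv_mul_iff_mul_eq,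
    eq_comm]

/-- The quartic symbols of `x` and `y` modulo `c + di`, compared. -/
theorem quarticSymbol_eq_zpow_mul_quarticSymbol {p q : ℕ} (hp : p.Prime) (hq : q.Prime)
    (hq8 : q % 8 = 3) {c d x y m e : ℤ} (hcd : (p : ℤ) = c ^ 2 + d ^ 2)
    (hxy : 4 * (p : ℤ) = x ^ 2 + (q : ℤ) * y ^ 2) (hc : c % 4 = 1) (hx : x % 2 = 1)
    (hy : y % 4 = 1) (hgcd : IsCoprime c (x + 2 * d) ∨ IsCoprime d (x + 2 * c))
    (h : (q : GaussianInt) ∣ (2 * star ((c : GaussianInt) + d * imagUnit)) ^ ((q + 1) / 4) -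
      x ^ ((q + 1) / 4) * ((imagUnits ^ m : (GaussianInt)ˣ) : GaussianInt))
    (he : (p % 8 = 1 ∧ e = x / 4 + 1) ∨ (p % 8 = 5 ∧ e = (x ^ 2 - 1) / 8)) :
    quarticSymbol x (c + d * imagUnit) = (imagUnits ^ (m + 2 * e) : (GaussianInt)ˣ) *
      quarticSymbol y (c + d * imagUnit) := by
  have hp4 : p % 4 = 1 := by omega
  obtain ⟨h1, h2, h3⟩ := isCoprime_of_four_mul_eq hp hq (by rintro rfl; omega)
    (by rintro rfl; omega) (by rintro rfl; omega) hxy (by omega)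
  obtain ⟨-, b, -, hb, -⟩ := exists_sum_two_squares_parametrization hcd (by omega) hc
  set π : GaussianInt := c + d * imagUnit with hπ
  have hre : π.re = c := by simp [hπ, imagUnit]
  have him : π.im = d := by simp [hπ, imagUnit]
  have hN : π.norm = p := by rw [norm_eq, hre, him, hcd]
  have hπ1 : 2 ∣ π - 1 := by rw [two_dvd_sub_one_iff, hre, him]; omega
  have hpy : IsCoprime y p := by
    have hpZ := Nat.prime_iff_prime_int.1 hp
    refine ((hpZ.irreducible.coprime_iff_not_dvd).2 fun hd => ?_).symm
    have h4 : (p : ℤ) ∣ x ^ 2 := by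
      rw [show x ^ 2 = p * 4 - y * (q * y) by linear_combination -hxy]
      exact dvd_sub (dvd_mul_right _ _) (hd.mul_right _)
    exact hpZ.not_isUnit (h1.isUnit_of_dvd' (hpZ.dvd_of_dvd_pow h4) dvd_rfl)
  have hcop {a : ℤ} (ha : IsCoprime a p) : IsCoprime (a : GaussianInt) π :=
    (isCoprime_intCast ha).of_isCoprime_of_dvd_right
      (by rw [Int.cast_natCast]; exact dvd_natCast_of_norm_eq hN)
  have hX := quarticSymbol_eq_zpow_mul_intCast hx hπ1 (hcop h1) hN
  have hY := quarticSymbol_intCast_eq hy hπ1 (hcop hpy)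
  have he' : ((p : ℤ) % 8 = 1 ∧ e = x / 4 + 1) ∨ ((p : ℤ) % 8 = 5 ∧ e = (x ^ 2 - 1) / 8) := by
    omega
  rcases hgcd with hg | hg
  -- i³π = -iπ = d - ci, so the condition on c and x + 2d is the required one for the pair (d, -c).
  · have hrot : ((d : GaussianInt) + (-c : ℤ) * imagUnit) = imagUnit ^ 3 * π := by
      rw [hπ]; push_cast
      linear_combination -((c : GaussianInt) * imagUnit + d * imagUnit ^ 2 - d) * imagUnit_sq
    have hodd (a : ℤ) (ha : a % 2 = 1) : quarticSymbol (imagUnit ^ 3 * π) a =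
        (imagUnits ^ ((a ^ 2 - 1) / 4) : (GaussianInt)ˣ) * quarticSymbol π a := by
      have ha2 := isCoprime_intCast_two ha
      rw [quarticSymbol_mul_left _ _ ha2, quarticSymbol_pow_left _ _ ha2, pow_succ,
        quarticSymbol_imagUnit_intCast_sq ha, one_mul, quarticSymbol_imagUnit_intCast ha]
    -- Conjugating -iπ gives iπ̄, so the hypothesis is multiplied by i^((q+1)/4).
    have h' : (q : GaussianInt) ∣
        (2 * star ((d : GaussianInt) + (-c : ℤ) * imagUnit)) ^ ((q + 1) / 4) -
        x ^ ((q + 1) / 4) *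
          ((imagUnits ^ (((q : ℤ) + 1) / 4 + m) : (GaussianInt)ˣ) : GaussianInt) := by
      have h4 : ((imagUnits ^ (((q : ℤ) + 1) / 4) : (GaussianInt)ˣ) : GaussianInt) =
          imagUnit ^ ((q + 1) / 4) := by
        rw [show ((q : ℤ) + 1) / 4 = (((q + 1) / 4 : ℕ) : ℤ) by push_cast; rfl, zpow_natCast,
          Units.val_pow_eq_pow_val]
        rfl
      rw [hrot, star_mul, star_pow, star_imagUnit, zpow_add, Units.val_mul, h4]
      convert h.mul_left (imagUnit ^ ((q + 1) / 4)) using 1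
      rw [show 2 * (star π * (-imagUnit) ^ 3) = imagUnit * (2 * star π) by
        linear_combination -(2 * star π * imagUnit) * imagUnit_sq, mul_pow imagUnit]
      ring
    have key := zpow_mul_quarticSymbol_eq hp hq hp4 hq8 (C := d) (D := -c) (by rw [hcd]; ring)
      hxy hx hy hg.neg_left h'
    rw [hrot, hodd x hx, hodd y (by omega), ← hY, hX, ← mul_assoc, ← mul_assoc, ← mul_assoc,
      ← Units.val_mul, ← Units.val_mul, ← Units.val_mul, ← zpow_add, ← zpow_add, ← zpow_add,
      zpow_mul_eq_iff] at key
    rw [key]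
    congr 2
    apply imagUnits_zpow_eq_of_emod_eq
    rw [← exponent_emod_four_of_coprime_left hcd hxy hx hc hy (by omega) he']
    congr 1
    ring
  · have key := zpow_mul_quarticSymbol_eq hp hq hp4 hq8 hcd hxy hx hy hg h
    rw [← hπ, ← hY, hX, ← mul_assoc, ← Units.val_mul, ← zpow_add, zpow_mul_eq_iff] at key
    rw [key]
    congr 2
    apply imagUnits_zpow_eq_of_emod_eq
    rw [← exponent_emod_four_of_coprime_right hcd hx hc he']
    congr 1
    ring

end GaussianInt

/-! ### The theorem -/

open GaussianInt in
theorem theorem3p3 (p q : ℕ) [Fact p.Prime] [Fact q.Prime]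
    (hp : p ≡ 1 [MOD 4]) (hq : q ≡ 3 [MOD 8])
    (c d x y m : ℤ)
    (hcd : (p : ℤ) = c ^ 2 + d ^ 2)
    (hxy : 4 * (p : ℤ) = x ^ 2 + (q : ℤ) * y ^ 2)
    (hc : c ≡ 1 [ZMOD 4]) (hy : y ≡ 1 [ZMOD 4])
    (hgcd : Int.gcd c (x + 2 * d) = 1 ∨ Int.gcd d (x + 2 * c) = 1)
    (hm : GaussianCongr (q : ℤ)
      ((2 * ((c : ℂ) - (d : ℂ) * Complex.I) / (x : ℂ)) ^ ((q + 1) / 4)) (Complex.I ^ m)) :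
    (p ≡ 1 [MOD 8] →
      (-(q : ZMod p)) ^ (p / 8) =
        (-1 : ZMod p) ^ (x / 4 + 1) * ((d : ZMod p) / (c : ZMod p)) ^ m) ∧
    (p ≡ 5 [MOD 8] →
      (-(q : ZMod p)) ^ (p / 8) =
        (-1 : ZMod p) ^ ((x ^ 2 - 1) / 8) * ((d : ZMod p) / (c : ZMod p)) ^ m *
          ((y : ZMod p) / (x : ZMod p))) := by
  have hpp : p.Prime := Fact.out
  have hqp : q.Prime := Fact.out
  have hp4 : p % 4 = 1 := hp
  have hq8 : q % 8 = 3 := hq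
  have hc4 : c % 4 = 1 := hc
  have hy4 : y % 4 = 1 := hy
  have hpZ := Nat.prime_iff_prime_int.1 hpp
  have hx : x % 2 = 1 := by
    obtain ⟨s, rfl⟩ : ∃ s, y = 2 * s + 1 := ⟨y / 2, by omega⟩
    obtain ⟨r, hr⟩ : ∃ r, (q : ℤ) = 2 * r + 1 := ⟨q / 2, by omega⟩
    rcases Int.even_or_odd' x with ⟨t, rfl | rfl⟩
    · rw [hr] at hxy
      ring_nf at hxy
      omega
    · omega
  obtain ⟨h1, h2, h3⟩ := isCoprime_of_four_mul_eq hpp hqp (by rintro rfl; omega)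
    (by rintro rfl; omega) (by rintro rfl; omega) hxy (by omega)
  have hxp : ¬ (p : ℤ) ∣ x := fun hd => hpZ.not_isUnit (h1.isUnit_of_dvd' hd dvd_rfl)
  have hyp : ¬ (p : ℤ) ∣ y := fun hd => by
    refine hxp (hpZ.dvd_of_dvd_pow (n := 2) ?_)
    rw [show x ^ 2 = p * 4 - y * (q * y) by linear_combination -hxy]
    exact dvd_sub (dvd_mul_right _ _) (hd.mul_right _)
  have hcp : ¬ (p : ℤ) ∣ c := fun hd => by
    have hd' : (p : ℤ) ∣ d := by
      refine hpZ.dvd_of_dvd_pow (n := 2) ?_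
      rw [show d ^ 2 = p * 1 - c * c by linear_combination -hcd]
      exact dvd_sub (dvd_mul_right _ _) (hd.mul_right _)
    obtain ⟨a, rfl⟩ := hd
    obtain ⟨b, rfl⟩ := hd'
    refine hpZ.not_isUnit (isUnit_of_dvd_one ⟨a ^ 2 + b ^ 2, mul_left_cancel₀ hpZ.ne_zero ?_⟩)
    linear_combination hcd
  have cast_ne {a : ℤ} (ha : ¬ (p : ℤ) ∣ a) : (a : ZMod p) ≠ 0 := by
    rwa [ne_eq, ZMod.intCast_zmod_eq_zero_iff_dvd]
  have hx0 : x ≠ 0 := by rintro rfl; omega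
  set π : GaussianInt := c + d * imagUnit with hπ
  have hN : π.norm = p := by rw [norm_eq, hcd]; simp [hπ, imagUnit]
  have hπp := prime_of_norm_eq_natPrime hpp hN
  have hπ2 := not_dvd_two_of_isCoprime hπp (isCoprime_two_iff.2 (by rw [hN]; omega))
  have hdvd := dvd_of_gaussianCongr (π := π) hx0 (m := m) (k := (q + 1) / 4) (by
    convert hm using 4
    rw [hπ, star_add, star_mul, star_imagUnit, star_intCast, star_intCast, toComplex_def]
    simp [imagUnit]
    ring)
  obtain ⟨θ, hθi, hθπ⟩ := exists_ringHom_zmod hcd (cast_ne hcp)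
  have hj2 : ((d : ZMod p) / c) ^ (2 : ℤ) = -1 := by
    rw [← hθi]
    have := congrArg θ imagUnit_sq
    rw [map_pow, map_neg, map_one] at this
    exact_mod_cast this
  have hj0 : (d : ZMod p) / c ≠ 0 := by
    intro h
    rw [h] at hj2
    norm_num at hj2
  have hEuler {a : ℤ} (ha : ¬ (p : ℤ) ∣ a) : θ (quarticSymbol a π) = (a : ZMod p) ^ (p / 4) :=
    map_quarticSymbol_intCast hπp hπ2 hN θ hθπ
      (by rwa [dvd_intCast_iff_of_norm_eq hpp hN])
  -- Apply ℤ[i] → ZMod p to the comparison of symbols: Euler's criterion gives the powers of x and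
  -- y, i becomes d/c, and (d/c)^(2e) = (-1)^e.
  have key (e : ℤ) (he : (p % 8 = 1 ∧ e = x / 4 + 1) ∨ (p % 8 = 5 ∧ e = (x ^ 2 - 1) / 8)) :
      (x : ZMod p) ^ (p / 4) = (-1) ^ e * ((d : ZMod p) / c) ^ m * (y : ZMod p) ^ (p / 4) := by
    have h := congrArg θ (quarticSymbol_eq_zpow_mul_quarticSymbol hpp hqp hq8 hcd hxy hc4 hx hy4
      (by simpa only [Int.isCoprime_iff_gcd_eq_one] using hgcd) hdvd he)
    rw [map_mul, hEuler hxp, hEuler hyp, map_imagUnits_zpow, hθi, zpow_add₀ hj0, zpow_mul,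
      hj2] at h
    rw [h, mul_comm (((d : ZMod p) / c) ^ m)]
  have hx' := cast_ne hxp
  have hy' := cast_ne hyp
  have hq' : -(q : ZMod p) = ((x : ZMod p) / y) ^ 2 := by
    have h := congrArg (Int.cast (R := ZMod p)) hxy
    push_cast at h
    rw [ZMod.natCast_self] at h
    field_simp
    linear_combination h
  constructor
  · intro h8
    have h8' : p % 8 = 1 := h8
    rw [hq', ← pow_mul, show 2 * (p / 8) = p / 4 by omega, div_pow, key _ (Or.inl ⟨h8', rfl⟩)]
    field_simp
  · intro h8
    have h8' : p % 8 = 5 := h8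
    have h := key _ (Or.inr ⟨h8', rfl⟩)
    -- For p ≡ 5 (mod 8) the exponent (p-1)/4 is odd; the surplus factor x/y moves across as y/x.
    rw [show p / 4 = 2 * (p / 8) + 1 by omega, pow_succ, pow_succ] at h
    rw [hq', ← pow_mul, div_pow, div_eq_iff (pow_ne_zero _ hy'), mul_div_assoc', div_mul_eq_mul_div,
      eq_div_iff hx', h]
    ring_nf
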